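/- **Setting.** Let $M,N\ge 1$, $X\ge 0$, $K_1,\dots,K_M\ge 1$ and $T_1,\dots,T_M\ge 0$ be integers. For a prime power $q$ and an integer $L\ge 1$, an *$M$-way blind $X$-secure $T$-private information retrieval (MB-XS-TPIR) scheme* consists of jointly distributed discrete (countably valued) random variables as follows. * A database $\mathbf W=(\mathbf W(k_1,\dots,k_M))_{k_m\in[1:K_m]}$ of messages, each made of $L$ symbols of $\mathbb F_q$, all symbols of all messages being i.i.d. uniform; the contents $\mathbf S_1,\dots,\mathbf S_N$ of the $N$ servers, which together determine $\mathbf W$; indices $\theta_m$ uniform on $[1:K_m]$ and private randomness $\mathcal Z_m$ of the users $m\in[1:M]$; and common randomness $\widetilde{\mathcal Z}$ of the servers. The variables $\mathbf S_{[1:N]},\ \widetilde{\mathcal Z},\ \theta_1,\dots,\theta_M,\ \mathcal Z_1,\dots,\mathcal Z_M$ are mutually independent. * $X$-security: $I(\mathbf W;\mathbf S_{\mathcal X})=0$ for all $\mathcal X\subset[1:N]$ with $|\mathcal X|\le X$; if $X=0$, every server stores exactly $\mathbf W$. * Queries: user $m$ sends a query $Q_n^{(m)}$ to each server $n$, and $H(Q_{[1:N]}^{(m)}\mid\theta_m,\mathcal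 Z_m)=0$. * Answers: server $n$ returns to all users a string $A_n$ of $q$-ary symbols with $H(A_n\mid \mathbf S_n,(Q_n^{(m)})_{m\in[1:M]},\widetilde{\mathcal Z})=0$. Its length may vary, but given the queries received by server $n$ no possible value of $A_n$ is a proper prefix of another one. * $T_m$-privacy: $I(\theta_m;(Q_{\mathcal T}^{(i)})_{i\in[1:M]}\mid \mathbf S_{\mathcal T},\widetilde{\mathcal Z})=0$ for all $m$ and all $\mathcal T\subset[1:N]$ with $|\mathcal T|\le T_m$. * Inter-user privacy: $I(\theta_{[1:M]\setminus\{m\}};A_{[1:N]}\mid\theta_m,\mathcal Z_m,\mathbf W(\theta_1,\dots,\theta_M))=0$ for all $m$. * Correctness: $H(\mathbf W(\theta_1,\dots,\theta_M)\mid A_{[1:N]},\theta_m,\mathcal Z_m)=0$ for all $m$. The rate of the scheme is $L/D$, where $D$ is the maximum, over all realizations (of positive probability), of the total number of $q$-ary symbols in $A_1,\dots,A_N$ (the rate is $0$ if $D=\infty$). Let $R^*$ be the supremum of the rates of all MB-XS-TPIR schemes with the parameters $q,L,N,X,K_1,\dots,K_M,T_1,\dots,T_M$, and let the capacity be $C_{\text{MB-XS-TPIR}}=\sup_{q,L}R^*$.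 **Corollary.** If $X+T_m<N$ for every $m\in[1:M]$, then $$1-\frac{X+T_1+\cdots+T_M}{N}\ \le\ C_{\text{MB-XS-TPIR}}\ \le\ \min_{m\in[1:M]}\ \frac{1-\frac{T_m+X}{N}}{1-\left(\frac{T_m}{N-X}\right)^{K_m}}.$$ -/

import Mathlib

open MeasureTheory ProbabilityTheory
open scoped ENNReal

namespace MBXSTPIR

section Information

variable {Ω α β γ : Type*} [MeasurableSpace Ω]

/-- Shannon entropy `H(A)` (in nats) of a discrete random variable `A` under the law `μ`. -/
noncomputable def entropy (μ : Measure Ω) (A : Ω → α) : ℝ≥0∞ :=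
  ∑' a, ENNReal.ofReal (Real.negMulLog (μ.real (A ⁻¹' {a})))

/-- Conditional Shannon entropy `H(A | B) = ∑_b P(B = b) H(A | B = b)` of discrete random
variables. -/
noncomputable def condEntropy (μ : Measure Ω) (A : Ω → α) (B : Ω → β) : ℝ≥0∞ :=
  ∑' b, μ (B ⁻¹' {b}) * entropy (μ[|B ⁻¹' {b}]) A

/-- Mutual information `I(A ; B)`: the Kullback-Leibler divergence of the joint law from the
product of the marginal laws. -/
noncomputable def mutualInfo [MeasurableSpace α] [MeasurableSpace β]
    (μ : Measure Ω) (A : Ω → α) (B : Ω → β) : ℝ≥0∞ :=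
  InformationTheory.klDiv (μ.map fun ω => (A ω, B ω)) ((μ.map A).prod (μ.map B))

/-- Conditional mutual information `I(A ; B | C) = ∑_c P(C = c) I(A ; B | C = c)`, for a discrete
random variable `C`. -/
noncomputable def condMutualInfo [MeasurableSpace α] [MeasurableSpace β]
    (μ : Measure Ω) (A : Ω → α) (B : Ω → β) (C : Ω → γ) : ℝ≥0∞ :=
  ∑' c, μ (C ⁻¹' {c}) * mutualInfo (μ[|C ⁻¹' {c}]) A B

end Information

/-- Strings over an alphabet of `q` symbols. -/
abbrev QString (q : ℕ) : Type := List (Fin q)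

/-- Strings form a countable set, on which every subset is measurable. -/
instance (q : ℕ) : MeasurableSpace (QString q) := ⊤

/-- An `M`-way blind `X`-secure `T`-private information retrieval scheme with `N` servers, security
level `X`, message length `L` over an alphabet of `q` symbols, `K m` possible indices for user `m`,
and privacy level `T m` for the index of user `m`.

All random variables are discrete. The (arbitrary, countable) alphabets of storage, randomness and
queries are labelled by natural numbers. -/
structure Scheme (q L : ℕ) {M : ℕ} (N X : ℕ) (K T : Fin M → ℕ) where
  /-- The underlying probability space. -/
  Ω : Type
  [measΩ : MeasurableSpace Ω]
  μ : Measure Ω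
  [prob : IsProbabilityMeasure μ]
  /-- The database: `W ω k` is the message with index tuple `k`, made of `L` symbols. -/
  W : Ω → ((m : Fin M) → Fin (K m)) → Fin L → Fin q
  /-- `S n` is the content stored at server `n`. -/
  S : Fin N → Ω → ℕ
  /-- The index of user `m`. -/
  θ : (m : Fin M) → Ω → Fin (K m)
  /-- The private randomness of user `m`. -/
  Z : Fin M → Ω → ℕ
  /-- The common randomness of the servers. -/
  Zc : Ω → ℕ
  /-- `Q m n` is the query sent by user `m` to server `n`. -/
  Q : Fin M → Fin N → Ω → ℕ
  /-- `A n` is the answer of server `n`, a string of `q`-ary symbols. -/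
  A : Fin N → Ω → QString q
  measurable_W : Measurable W
  measurable_S : ∀ n, Measurable (S n)
  measurable_θ : ∀ m, Measurable (θ m)
  measurable_Z : ∀ m, Measurable (Z m)
  measurable_Zc : Measurable Zc
  measurable_Q : ∀ m n, Measurable (Q m n)
  measurable_A : ∀ n, Measurable (A n)
  /-- The symbols of all messages are i.i.d. uniform. -/
  uniform_W : μ.map W = uniformOn Set.univ
  /-- The index of every user is uniform. -/
  uniform_θ : ∀ m, μ.map (θ m) = uniformOn Set.univ
  /-- The database is stored at the servers: it is determined by their joint content. -/
  stored : condEntropy μ W (fun ω n => S n ω) = 0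
  /-- `X`-security: any `X` or fewer servers learn nothing about the database. -/
  security : ∀ 𝒳 : Finset (Fin N), 𝒳.card ≤ X →
    mutualInfo μ W (fun ω (n : 𝒳) => S n ω) = 0
  /-- For `X = 0` the storage is replicated: the content of each server is the database
  (up to relabelling). -/
  replicated : X = 0 → ∀ n, condEntropy μ (S n) W = 0 ∧ condEntropy μ W (S n) = 0
  /-- The storage, the common randomness of the servers, the indices and the private
  randomnesses of the users are mutually independent. -/
  independent :
    μ.map (fun ω => ((fun n => S n ω), Zc ω, (fun m => θ m ω), (fun m => Z m ω))) =
      (μ.map (fun ω n => S n ω)).prod ((μ.map Zc).prod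
        ((Measure.pi fun m => μ.map (θ m)).prod (Measure.pi fun m => μ.map (Z m))))
  /-- The queries of user `m` are a function of its index and its private randomness. -/
  query : ∀ m, condEntropy μ (fun ω n => Q m n ω) (fun ω => (θ m ω, Z m ω)) = 0
  /-- The answer of server `n` is a function of its storage, the queries it receives and the
  common randomness. -/
  answer : ∀ n, condEntropy μ (A n) (fun ω => (S n ω, (fun m => Q m n ω), Zc ω)) = 0
  /-- Answers are self-delimiting: given the queries that server `n` receives, no possible answer
  is a proper prefix of another one. (Answers whose length is fixed, or is determined by the
  queries, are a special case.) -/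
  prefixFree : ∀ (n : Fin N) (v : Fin M → ℕ) (a b : QString q),
    μ {ω | (∀ m, Q m n ω = v m) ∧ A n ω = a} ≠ 0 →
    μ {ω | (∀ m, Q m n ω = v m) ∧ A n ω = b} ≠ 0 → a <+: b → a = b
  /-- `T m`-privacy: any `T m` or fewer servers learn nothing about the index of user `m`. -/
  privacy : ∀ (m : Fin M) (𝒯 : Finset (Fin N)), 𝒯.card ≤ T m →
    condMutualInfo μ (θ m) (fun ω (i : Fin M) (n : 𝒯) => Q i n ω)
      (fun ω => ((fun n : 𝒯 => S n ω), Zc ω)) = 0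
  /-- Inter-user privacy: no user learns anything about the indices of the other users beyond
  what the desired message reveals. -/
  interUserPrivacy : ∀ m : Fin M,
    condMutualInfo μ (fun ω (i : {i : Fin M // i ≠ m}) => θ i ω) (fun ω n => A n ω)
      (fun ω => (θ m ω, Z m ω, W ω (fun i => θ i ω))) = 0
  /-- Correctness: every user recovers the desired message. -/
  correct : ∀ m : Fin M,
    condEntropy μ (fun ω => W ω (fun i => θ i ω))
      (fun ω => ((fun n => A n ω), θ m ω, Z m ω)) = 0

namespace Scheme

variable {q L M N X : ℕ} {K T : Fin M → ℕ}

/-- The download cost `D`: the maximum, over all realizations of positive probability, of the total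
number of `q`-ary symbols downloaded from all servers (`⊤` if unbounded). -/
noncomputable def downloadCost (s : Scheme q L N X K T) : ℕ∞ :=
  letI := s.measΩ
  ⨆ (a : Fin N → QString q) (_ : s.μ {ω | ∀ n, s.A n ω = a n} ≠ 0),
    ((∑ n, (a n).length : ℕ) : ℕ∞)

/-- The rate `L / D`. -/
noncomputable def rate (s : Scheme q L N X K T) : ℝ≥0∞ :=
  (L : ℝ≥0∞) / (s.downloadCost : ℝ≥0∞)

end Scheme

/-- The supremum of the rates of all schemes with the given parameters. -/
noncomputable def supRate (q L : ℕ) {M : ℕ} (N X : ℕ) (K T : Fin M → ℕ) : ℝ≥0∞ :=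
  ⨆ s : Scheme q L N X K T, s.rate

/-- The capacity: the supremum of the achievable rates over all sizes `q` of a finite field and all
message lengths `L ≥ 1`. -/
noncomputable def capacity {M : ℕ} (N X : ℕ) (K T : Fin M → ℕ) : ℝ≥0∞ :=
  ⨆ (q : ℕ) (_ : IsPrimePow q) (L : ℕ) (_ : 1 ≤ L), supRate q L N X K T

end MBXSTPIR

/-! Upper bound. Fix a user `m`, and freeze the common randomness and the indices and private
randomness of all other users at values of positive probability. As the cost is a maximum over
realizations, this cannot raise it, and what remains is a single-user `X`-secure, `T m`-private
scheme for `K m` messages (`length_mul_geom_sum_mul_le_downloadCost`). Conditioning further on the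
content of `X` servers leaves the messages uniform by security and makes the answers of those
servers known functions of the queries. Hence the other `N - X` servers alone perform private
retrieval (`log_card_mul_geom_sum_le_of_secure`). For these, put `ρ = T m / (N - X)`. Once message
`k` is decoded, privacy allows the answers of any `T m` servers to be regarded as answers to a
request for message `k + 1`, and by submodularity some `T m` servers carry at least the share `ρ` of
the remaining entropy. Iterating, the answers carry at least `1 + ρ + ⋯ + ρ ^ (K m - 1)` messages
(`log_card_mul_geom_sum_le_integral_shannon`). Kraft's inequality converts entropy into expected
length (`shannon_restr_le_length`). Taking the `X` known servers to be those with the longest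
expected answers yields the factor `(N - X) / N`. Lower bound, by cross-subspace alignment. Messages
and index indicators are shared by polynomials, of degree `X` and `T m`, whose secret is the value
at a point `φ l`. A server multiplies its shares, sums over all index tuples, and divides by `φ l -
α n`. The product polynomial has degree at most `E = X + ∑ T m` and takes the desired symbol as its
value at `φ l`. The division therefore splits it into a Cauchy term carrying that symbol and a
polynomial of degree below `E` (`exists_answer_eq`). All interference shares the latter `E`
dimensions and is masked there by common randomness. With `L + E = N`, the Cauchy-Vandermonde system
is solvable (`cauchy_part_eq_zero`), so `N` downloaded symbols deliver `L = N - E`. -/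

namespace MBXSTPIR

/-! ### Shannon entropy of finitely valued variables -/

section Shannon

set_option linter.unusedSectionVars false

variable {Ω α β γ : Type*} [MeasurableSpace Ω]

/-- Shannon entropy, as a real number, of a finitely valued random variable. -/
noncomputable def shannon [Fintype α] (P : Measure Ω) (f : Ω → α) : ℝ :=
  ∑ a, Real.negMulLog (P.real (f ⁻¹' {a}))

/-- The logarithm is monotone and each `p i` is at most the sum. Splitting an event therefore never
lowers entropy, which gives `shannon_le_prod_left`. -/
theorem negMulLog_sum_le {ι : Type*} (s : Finset ι) (p : ι → ℝ) (hp : ∀ i ∈ s, 0 ≤ p i) :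
    Real.negMulLog (∑ i ∈ s, p i) ≤ ∑ i ∈ s, Real.negMulLog (p i) := by
  rw [Real.negMulLog, neg_mul, Finset.sum_mul, ← Finset.sum_neg_distrib]
  refine Finset.sum_le_sum fun i hi => ?_
  rw [Real.negMulLog, neg_mul, neg_le_neg_iff]
  rcases (hp i hi).eq_or_lt with h | h
  · simp [← h]
  · exact mul_le_mul_of_nonneg_left
      (Real.log_le_log h (Finset.single_le_sum hp hi)) h.le

/-- Nonnegativity of conditional mutual information on one slice of the conditioning variable, from
`log x ≤ x - 1` at `x = pa a * pb b / (pc * p a b)`. The weights are left unnormalised so that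
slices can simply be added up. -/
theorem sum_negMulLog_add_le [Fintype α] [Fintype β] (p : α → β → ℝ) (p0 : ∀ a b, 0 ≤ p a b) :
    ∑ a, ∑ b, Real.negMulLog (p a b) + Real.negMulLog (∑ b, ∑ a, p a b) ≤
      ∑ a, Real.negMulLog (∑ b, p a b) + ∑ b, Real.negMulLog (∑ a, p a b) := by
  obtain ⟨pa, hpa⟩ : ∃ pa : α → ℝ, ∀ a, pa a = ∑ b, p a b := ⟨_, fun _ => rfl⟩
  obtain ⟨pb, hpb⟩ : ∃ pb : β → ℝ, ∀ b, pb b = ∑ a, p a b := ⟨_, fun _ => rfl⟩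
  obtain ⟨pc, hpc⟩ : ∃ pc : ℝ, pc = ∑ b, pb b := ⟨_, rfl⟩
  have hpc' : pc = ∑ a, pa a := by simp_rw [hpc, hpa, hpb]; exact Finset.sum_comm
  have pa0 : ∀ a, 0 ≤ pa a := fun a => hpa a ▸ Finset.sum_nonneg fun b _ => p0 a b
  have pb0 : ∀ b, 0 ≤ pb b := fun b => hpb b ▸ Finset.sum_nonneg fun a _ => p0 a b
  have pc0 : 0 ≤ pc := hpc ▸ Finset.sum_nonneg fun b _ => pb0 b
  simp_rw [← hpa, ← hpb, ← hpc]
  have t1 : Real.negMulLog pc = ∑ a, ∑ b, -(p a b * Real.log pc) := by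
    simp_rw [Finset.sum_neg_distrib, ← Finset.sum_mul, ← hpa, ← hpc', Real.negMulLog, neg_mul]
  have t2 : ∑ a, Real.negMulLog (pa a) = ∑ a, ∑ b, -(p a b * Real.log (pa a)) := by
    simp_rw [Finset.sum_neg_distrib, ← Finset.sum_mul, ← hpa, Real.negMulLog, neg_mul,
      Finset.sum_neg_distrib]
  have t3 : ∑ b, Real.negMulLog (pb b) = ∑ a, ∑ b, -(p a b * Real.log (pb b)) := by
    rw [Finset.sum_comm]
    simp_rw [Finset.sum_neg_distrib, ← Finset.sum_mul, ← hpb, Real.negMulLog, neg_mul,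
      Finset.sum_neg_distrib]
  have hle : ∀ a b, Real.negMulLog (p a b) + -(p a b * Real.log pc) -
      (-(p a b * Real.log (pa a)) + -(p a b * Real.log (pb b))) ≤
      pa a * pb b / pc - p a b := by
    intro a b
    rcases (p0 a b).eq_or_lt with h | h
    · rw [← h]; simp only [Real.negMulLog_zero, zero_mul, neg_zero, add_zero, sub_zero]
      exact div_nonneg (mul_nonneg (pa0 a) (pb0 b)) pc0
    · have ha : 0 < pa a := by
        rw [hpa]
        exact h.trans_le (Finset.single_le_sum (f := fun b => p a b) (fun b _ => p0 a b)
          (Finset.mem_univ b))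
      have hb : 0 < pb b := by
        rw [hpb]
        exact h.trans_le (Finset.single_le_sum (f := fun a => p a b) (fun a _ => p0 a b)
          (Finset.mem_univ a))
      have hcc : 0 < pc := by
        rw [hpc]
        exact hb.trans_le (Finset.single_le_sum (fun b _ => pb0 b) (Finset.mem_univ b))
      have := Real.log_le_sub_one_of_pos (div_pos (div_pos (mul_pos ha hb) hcc) h)
      rw [Real.log_div (by positivity) h.ne', Real.log_div (by positivity) hcc.ne',
        Real.log_mul ha.ne' hb.ne'] at this
      have h3 := mul_le_mul_of_nonneg_left this h.le
      rw [mul_sub (p a b) (_ / p a b), mul_div_cancel₀ _ h.ne'] at h3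
      rw [Real.negMulLog]
      linarith
  have hsum := Finset.sum_le_sum fun a (_ : a ∈ Finset.univ) =>
    Finset.sum_le_sum fun b (_ : b ∈ Finset.univ) => hle a b
  have e2 : ∑ a, ∑ b, pa a * pb b / pc = pc := by
    simp_rw [← Finset.sum_div, ← Finset.mul_sum, ← hpc, ← Finset.sum_mul, ← hpc']
    rcases eq_or_ne pc 0 with h0 | h0
    · simp [h0]
    · field_simp
  rw [t1, t2, t3]
  simp_rw [Finset.sum_sub_distrib, Finset.sum_add_distrib] at hsum
  rw [e2] at hsum
  simp_rw [← hpa, ← hpc'] at hsum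
  linarith

variable [DiscreteMeasurableSpace Ω] (P : Measure Ω) [IsProbabilityMeasure P]

theorem sum_real_preimage_inter [Fintype β] (g : Ω → β) (s : Set Ω) :
    ∑ b, P.real (s ∩ g ⁻¹' {b}) = P.real s := by
  have h : P.real s = P.real (⋃ b ∈ (Finset.univ : Finset β), s ∩ g ⁻¹' {b}) := by
    congr 1; ext x; simp
  rw [h, measureReal_biUnion_finset]
  · intro b _ b' _ hb
    refine Set.disjoint_left.2 fun x hx hx' => hb ?_
    rw [← hx.2, ← hx'.2]
  · exact fun _ _ => .of_discrete

theorem sum_real_preimage [Fintype β] (g : Ω → β) : ∑ b, P.real (g ⁻¹' {b}) = 1 := by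
  simpa using sum_real_preimage_inter P g Set.univ

theorem shannon_nonneg [Fintype α] (f : Ω → α) : 0 ≤ shannon P f :=
  Finset.sum_nonneg fun _ _ => Real.negMulLog_nonneg measureReal_nonneg measureReal_le_one

theorem shannon_le_card [Fintype α] (f : Ω → α) : shannon P f ≤ Fintype.card α := by
  calc shannon P f ≤ ∑ _a : α, (1 : ℝ) := Finset.sum_le_sum fun a _ => by
        have h0 : 0 ≤ P.real (f ⁻¹' {a}) := measureReal_nonneg
        have := Real.negMulLog_le_one_sub_self h0
        linarith
    _ = _ := by simp

theorem shannon_prod [Fintype α] [Fintype β] (f : Ω → α) (g : Ω → β) :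
    shannon P (fun ω => (f ω, g ω)) =
      ∑ a, ∑ b, Real.negMulLog (P.real (f ⁻¹' {a} ∩ g ⁻¹' {b})) := by
  rw [shannon, Fintype.sum_prod_type]
  refine Finset.sum_congr rfl fun a _ => Finset.sum_congr rfl fun b _ => ?_
  congr 2
  ext x
  simp [Prod.ext_iff]

theorem shannon_le_prod_left [Fintype α] [Fintype β] (f : Ω → α) (g : Ω → β) :
    shannon P f ≤ shannon P (fun ω => (f ω, g ω)) := by
  rw [shannon_prod, shannon]
  refine Finset.sum_le_sum fun a _ => ?_
  rw [← sum_real_preimage_inter P g (f ⁻¹' {a})]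
  exact negMulLog_sum_le _ _ fun _ _ => measureReal_nonneg

/-- On a fibre of `g` of positive mass, `f` is constant off a null set, so adjoining `f` to `g` adds
no entropy. Testing only atoms of positive mass lets almost sure properties such as correct decoding
be used directly. -/
theorem shannon_le_of_determines [Countable Ω] [Fintype α] [Fintype β] (f : Ω → α) (g : Ω → β)
    (h : ∀ x y, P {x} ≠ 0 → P {y} ≠ 0 → g x = g y → f x = f y) :
    shannon P f ≤ shannon P g := by
  classical
  refine (shannon_le_prod_left P f g).trans ?_
  rw [shannon_prod, Finset.sum_comm, shannon]
  refine Finset.sum_le_sum fun b _ => ?_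
  have key : ∀ s : Set Ω, P s ≠ 0 → ∃ x ∈ s, P {x} ≠ 0 := by
    intro s hs
    by_contra! hc
    exact hs ((measure_null_iff_singleton s.to_countable).2 hc)
  by_cases hb : P (g ⁻¹' {b}) = 0
  · refine Finset.sum_nonpos (fun a _ => ?_) |>.trans
      (Real.negMulLog_nonneg measureReal_nonneg measureReal_le_one)
    have : P (f ⁻¹' {a} ∩ g ⁻¹' {b}) = 0 := measure_mono_null Set.inter_subset_right hb
    simp [Measure.real, this]
  · obtain ⟨x, hx, hPx⟩ := key _ hb
    rw [Finset.sum_eq_single (f x)]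
    · have hz : P (g ⁻¹' {b} \ (f ⁻¹' {f x})) = 0 := by
        by_contra hc
        obtain ⟨y, hy, hPy⟩ := key _ hc
        exact hy.2 (h y x hPy hPx (hy.1.trans hx.symm))
      have : P.real (f ⁻¹' {f x} ∩ g ⁻¹' {b}) = P.real (g ⁻¹' {b}) := by
        rw [Measure.real, Measure.real, ← measure_inter_add_sdiff (g ⁻¹' {b}) (t := f ⁻¹' {f x})
          .of_discrete, hz, add_zero, Set.inter_comm]
      rw [this]
    · intro a _ ha
      have : P (f ⁻¹' {a} ∩ g ⁻¹' {b}) = 0 := by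
        by_contra hc
        obtain ⟨y, hy, hPy⟩ := key _ hc
        exact ha (hy.1.symm.trans (h y x hPy hPx (hy.2.trans hx.symm)))
      simp [Measure.real, this]
    · simp

theorem shannon_congr [Countable Ω] [Fintype α] [Fintype β] (f : Ω → α) (g : Ω → β)
    (h : ∀ x y, P {x} ≠ 0 → P {y} ≠ 0 → (g x = g y ↔ f x = f y)) :
    shannon P f = shannon P g :=
  le_antisymm (shannon_le_of_determines P f g fun x y hx hy => (h x y hx hy).1)
    (shannon_le_of_determines P g f fun x y hx hy => (h x y hx hy).2)

/-- Gibbs' inequality, for a sub-probability reference weight. -/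
theorem shannon_le_sum_mul_neg_log [Fintype α] (f : Ω → α) (r : α → ℝ)
    (hr : ∀ a, 0 < r a) (hsum : ∑ a with P.real (f ⁻¹' {a}) ≠ 0, r a ≤ 1) :
    shannon P f ≤ ∑ a, P.real (f ⁻¹' {a}) * (-Real.log (r a)) := by
  classical
  set p : α → ℝ := fun a => P.real (f ⁻¹' {a}) with hp
  have h1 : ∑ a, p a = 1 := sum_real_preimage P f
  have h2 : ∀ a, Real.negMulLog (p a) - p a * (-Real.log (r a)) ≤
      (if p a ≠ 0 then r a else 0) - p a := by
    intro a
    have h0 : 0 ≤ p a := measureReal_nonneg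
    rcases h0.eq_or_lt with h | h
    · simp [← h]
    · rw [if_pos h.ne']
      have := Real.log_le_sub_one_of_pos (div_pos (hr a) h)
      rw [Real.log_div (hr a).ne' h.ne'] at this
      have h3 := mul_le_mul_of_nonneg_left this h.le
      rw [mul_sub, mul_sub, mul_div_cancel₀ _ h.ne'] at h3
      rw [Real.negMulLog]
      linarith
  have h3 := Finset.sum_le_sum fun a (_ : a ∈ Finset.univ) => h2 a
  rw [Finset.sum_sub_distrib, Finset.sum_sub_distrib, h1, ← Finset.sum_filter] at h3
  rw [shannon]
  linarith

/-- Disintegrate over the values of `h` and apply `sum_negMulLog_add_le` on each slice. -/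
theorem shannon_submodular [Fintype α] [Fintype β] [Fintype γ] (f : Ω → α) (g : Ω → β)
    (h : Ω → γ) :
    shannon P (fun ω => (f ω, g ω, h ω)) + shannon P h ≤
      shannon P (fun ω => (f ω, h ω)) + shannon P (fun ω => (g ω, h ω)) := by
  set p : α → β → γ → ℝ := fun a b c => P.real (f ⁻¹' {a} ∩ (g ⁻¹' {b} ∩ h ⁻¹' {c})) with hp
  have p0 : ∀ a b c, 0 ≤ p a b c := fun _ _ _ => measureReal_nonneg
  have hfc : ∀ a c, P.real (f ⁻¹' {a} ∩ h ⁻¹' {c}) = ∑ b, p a b c := by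
    intro a c
    rw [← sum_real_preimage_inter P g]
    refine Finset.sum_congr rfl fun b _ => ?_
    rw [hp]
    congr 1
    ext; simp; tauto
  have hgc : ∀ b c, P.real (g ⁻¹' {b} ∩ h ⁻¹' {c}) = ∑ a, p a b c := by
    intro b c
    rw [← sum_real_preimage_inter P f]
    refine Finset.sum_congr rfl fun b _ => ?_
    rw [hp]
    congr 1
    ext; simp; tauto
  have hc : ∀ c, P.real (h ⁻¹' {c}) = ∑ b, ∑ a, p a b c := by
    intro c
    rw [← sum_real_preimage_inter P g]
    refine Finset.sum_congr rfl fun b _ => ?_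
    rw [← hgc, Set.inter_comm]
  have e1 : shannon P (fun ω => (f ω, g ω, h ω)) =
      ∑ c, ∑ a, ∑ b, Real.negMulLog (p a b c) := by
    rw [shannon_prod P f fun ω => (g ω, h ω)]
    simp_rw [Fintype.sum_prod_type]
    have : ∀ a b c, P.real (f ⁻¹' {a} ∩ (fun ω => (g ω, h ω)) ⁻¹' {(b, c)}) = p a b c := by
      intro a b c
      rw [hp]; congr 1; ext; simp [Prod.ext_iff]
    simp_rw [this]
    rw [Finset.sum_comm (γ := γ)]
    refine Finset.sum_congr rfl fun a _ => Finset.sum_comm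
  rw [e1, shannon_prod, shannon_prod, shannon, Finset.sum_comm (s := (Finset.univ : Finset α)),
    Finset.sum_comm (s := (Finset.univ : Finset β)), ← Finset.sum_add_distrib,
    ← Finset.sum_add_distrib]
  refine Finset.sum_le_sum fun c _ => ?_
  simp_rw [hfc, hgc, hc]
  exact sum_negMulLog_add_le (fun a b => p a b c) fun a b => p0 a b c

end Shannon

/-! ### Proportional shares of additive and submodular functions -/

section Combinatorics

variable {ι : Type*} [LinearOrder ι]

/-- Some subset of prescribed size carries at least its proportional share of a sum. -/
theorem exists_subset_card_mul_sum_le (s : Finset ι) (w : ι → ℝ) (t : ℕ) (ht : t ≤ s.card) :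
    ∃ τ ⊆ s, τ.card = t ∧ t * ∑ i ∈ s, w i ≤ s.card * ∑ i ∈ τ, w i := by
  obtain ⟨u, hu⟩ : ∃ u, s.card = t + u := ⟨_, (Nat.add_sub_cancel' ht).symm⟩
  clear ht
  induction u generalizing s with
  | zero => exact ⟨s, subset_rfl, by omega, by rw [hu]; simp⟩
  | succ u ih =>
    have hne : s.Nonempty := Finset.card_pos.1 (by omega)
    -- Discarding an element of least weight does not lower the average.
    obtain ⟨j, hj, hmin⟩ := s.exists_min_image w hne
    have hc : (s.erase j).card = t + u := by rw [Finset.card_erase_of_mem hj]; omega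
    obtain ⟨τ, hτ, hτc, hτs⟩ := ih (s.erase j) hc
    refine ⟨τ, hτ.trans (Finset.erase_subset _ _), hτc, ?_⟩
    have h1 : w j * t ≤ ∑ i ∈ τ, w i := by
      have := Finset.card_nsmul_le_sum τ w (w j)
        fun i hi => hmin i ((hτ.trans (Finset.erase_subset _ _)) hi)
      rw [hτc, nsmul_eq_mul] at this
      linarith
    rw [← Finset.add_sum_erase s w hj, hu]
    rw [hc] at hτs
    push_cast at hτs ⊢
    nlinarith

/-- For a function with decreasing marginals, some subset of prescribed size carries at least
its proportional share of the total increment. -/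
theorem exists_subset_card_mul_le_of_submodular (G : Finset ι → ℝ)
    (hG : ∀ σ τ : Finset ι, ∀ j, σ ⊆ τ → G (insert j τ) - G τ ≤ G (insert j σ) - G σ)
    (s : Finset ι) (t : ℕ) (ht : t ≤ s.card) :
    ∃ τ ⊆ s, τ.card = t ∧ t * (G s - G ∅) ≤ s.card * (G τ - G ∅) := by
  classical
  -- The increment of `j` over the elements of `s` before it. These telescope to the total over `s`,
  -- whereas for a subset they only underestimate its own increments, whose base sets are smaller.
  -- This reduces the claim to the additive case.
  set δ : ι → ℝ := fun j =>
    G (insert j (s.filter (· < j))) - G (s.filter (· < j)) with hδ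
  have hle : ∀ τ : Finset ι, τ ⊆ s → ∑ j ∈ τ, δ j ≤ G τ - G ∅ := by
    intro τ
    induction τ using Finset.induction_on_max with
    | empty => simp
    | insert a τ ha ih =>
      intro hsub
      have hna : a ∉ τ := fun h => lt_irrefl _ (ha a h)
      rw [Finset.sum_insert hna]
      have h1 := ih ((Finset.subset_insert a τ).trans hsub)
      have h2 : δ a ≤ G (insert a τ) - G τ := hG τ (s.filter (· < a)) a fun x hx =>
        Finset.mem_filter.2 ⟨hsub (Finset.mem_insert_of_mem hx), ha x hx⟩
      linarith
  have heq : ∀ τ : Finset ι, (∀ i ∈ s, ∀ j ∈ τ, i < j → i ∈ τ) → τ ⊆ s →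
      ∑ j ∈ τ, δ j = G τ - G ∅ := by
    intro τ
    induction τ using Finset.induction_on_max with
    | empty => simp
    | insert a τ ha ih =>
      intro hlow hsub
      have hna : a ∉ τ := fun h => lt_irrefl _ (ha a h)
      have hpre : s.filter (· < a) = τ := by
        ext x
        rw [Finset.mem_filter]
        constructor
        · rintro ⟨hx, hxa⟩
          exact (Finset.mem_insert.1 (hlow x hx a (Finset.mem_insert_self _ _) hxa)).resolve_left
            hxa.ne
        · exact fun hx => ⟨hsub (Finset.mem_insert_of_mem hx), ha x hx⟩
      rw [Finset.sum_insert hna, ih _ ((Finset.subset_insert a τ).trans hsub), hδ]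
      · simp only [hpre]; ring
      · intro i hi j hj hij
        exact (Finset.mem_insert.1 (hlow i hi j (Finset.mem_insert_of_mem hj) hij)).resolve_left
          (hij.trans (ha j hj)).ne
  obtain ⟨τ, hτ, hτc, hτs⟩ := exists_subset_card_mul_sum_le s δ t ht
  refine ⟨τ, hτ, hτc, ?_⟩
  rw [heq s (fun i hi _ _ _ => hi) subset_rfl] at hτs
  exact hτs.trans (mul_le_mul_of_nonneg_left (hle τ hτ) (Nat.cast_nonneg _))

end Combinatorics

/-! ### Kraft's inequality for prefix-free codes -/

section Kraft

variable {α : Type*}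

/-- The first words of two factorizations are prefixes of the same string, hence comparable, hence
equal, and can be cancelled. -/
theorem uniquelyDecodable_of_prefixFree (S : Set (List α)) (hnil : [] ∉ S)
    (h : ∀ a ∈ S, ∀ b ∈ S, a <+: b → a = b) : InformationTheory.UniquelyDecodable S := by
  intro l₁
  induction l₁ with
  | nil =>
    intro l₂ _ h₂ he
    cases l₂ with
    | nil => rfl
    | cons b l₂ =>
      simp only [List.flatten_nil, List.flatten_cons] at he
      have : b = [] := (List.append_eq_nil_iff.1 he.symm).1
      exact absurd (this ▸ h₂ b (by simp)) hnil
  | cons a l₁ ih =>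
    intro l₂ h₁ h₂ he
    cases l₂ with
    | nil =>
      simp only [List.flatten_nil, List.flatten_cons] at he
      have : a = [] := (List.append_eq_nil_iff.1 he).1
      exact absurd (this ▸ h₁ a (by simp)) hnil
    | cons b l₂ =>
      simp only [List.flatten_cons] at he
      have ha := h₁ a (by simp)
      have hb := h₂ b (by simp)
      have hab : a = b := by
        rcases List.prefix_or_prefix_of_prefix (List.prefix_append a l₁.flatten)
          (he ▸ List.prefix_append b l₂.flatten) with hp | hp
        · exact h a ha b hb hp
        · exact (h b hb a ha hp).symm
      subst hab
      rw [ih l₂ (fun w hw => h₁ w (by simp [hw])) (fun w hw => h₂ w (by simp [hw]))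
        (List.append_cancel_left he)]

/-- Kraft's inequality for prefix-free codes. -/
theorem kraft_of_prefixFree [Fintype α] [Nonempty α] (S : Finset (List α))
    (h : ∀ a ∈ S, ∀ b ∈ S, a <+: b → a = b) :
    ∑ w ∈ S, (1 / Fintype.card α : ℝ) ^ w.length ≤ 1 := by
  -- Unique decodability excludes the empty word, but a prefix-free set containing it is a
  -- singleton.
  by_cases hnil : [] ∈ S
  · have : S = {[]} := by
      refine Finset.eq_singleton_iff_unique_mem.2 ⟨hnil, fun x hx => ?_⟩
      exact (h [] hnil x hx List.nil_prefix).symm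
    simp [this]
  · exact InformationTheory.kraft_mcmillan_inequality
      (uniquelyDecodable_of_prefixFree _ (by simpa using hnil) (by simpa using h))

end Kraft

/-! ### Noiseless coding bound -/

section Converse

set_option linter.unusedSectionVars false

/-- Strings of length at most `d`. -/
abbrev BoundedString (q d : ℕ) : Type := {l : List (Fin q) // l.length ≤ d}

noncomputable instance (q d : ℕ) : Fintype (BoundedString q d) :=
  (List.finite_length_le (Fin q) d).fintype

variable {Ω α β γ ι : Type*} [MeasurableSpace Ω] [DiscreteMeasurableSpace Ω] [Countable Ω]
  (P : Measure Ω) [IsProbabilityMeasure P]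

theorem shannon_le_log_card [Fintype α] [Nonempty α] (f : Ω → α) :
    shannon P f ≤ Real.log (Fintype.card α) := by
  have hpos : (0 : ℝ) < Fintype.card α := by exact_mod_cast Fintype.card_pos
  refine (shannon_le_sum_mul_neg_log P f (fun _ => (Fintype.card α : ℝ)⁻¹)
    (fun _ => inv_pos.2 hpos) ?_).trans ?_
  · refine (Finset.sum_le_sum_of_subset_of_nonneg (Finset.filter_subset _ _)
      fun _ _ _ => (inv_pos.2 hpos).le).trans ?_
    simp [hpos.ne']
  · rw [← Finset.sum_mul, sum_real_preimage P f]
    simp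

theorem shannon_prod_le_add [Fintype α] [Fintype β] (f : Ω → α) (g : Ω → β) :
    shannon P (fun ω => (f ω, g ω)) ≤ shannon P f + shannon P g := by
  have h := shannon_submodular P f g fun _ => ()
  have e0 := shannon_nonneg P (fun _ : Ω => ())
  rw [shannon_congr P (fun ω => (f ω, g ω, ())) (fun ω => (f ω, g ω)) (by simp),
    shannon_congr P (fun ω => (f ω, ())) f (by simp),
    shannon_congr P (fun ω => (g ω, ())) g (by simp)] at h
  linarith

theorem integral_comp_of_fintype [Fintype α] (f : Ω → α) (φ : α → ℝ) :
    ∫ ω, φ (f ω) ∂P = ∑ a, P.real (f ⁻¹' {a}) * φ a := by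
  let _ : MeasurableSpace α := ⊤
  have : DiscreteMeasurableSpace α := ⟨fun _ => trivial⟩
  have hf : Measurable f := .of_discrete
  have : IsProbabilityMeasure (P.map f) := Measure.isProbabilityMeasure_map hf.aemeasurable
  rw [← integral_map hf.aemeasurable (Measurable.of_discrete).aestronglyMeasurable,
    integral_fintype Integrable.of_finite]
  refine Finset.sum_congr rfl fun a _ => ?_
  rw [map_measureReal_apply hf (measurableSet_singleton a), smul_eq_mul]

/-- The coordinates of `a` in `τ`. -/
def restr [DecidableEq ι] (τ : Finset ι) (a : ι → α) : ι → Option α :=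
  fun n => if n ∈ τ then some (a n) else none

theorem restr_eq_restr_iff [DecidableEq ι] (τ : Finset ι) (a b : ι → α) :
    restr τ a = restr τ b ↔ ∀ n ∈ τ, a n = b n := by
  simp only [funext_iff, restr]
  refine forall_congr' fun n => ?_
  by_cases h : n ∈ τ <;> simp [h]

/-- Noiseless coding bound: the joint entropy of prefix-free encoded strings is at most
their expected total length. -/
theorem shannon_restr_le_length [DecidableEq ι] [Fintype ι] {q d : ℕ} (hq : 1 ≤ q)
    (𝒩 : Finset ι)
    (a : ι → Ω → BoundedString q d)
    (hpf : ∀ n ∈ 𝒩, ∀ x y, P {x} ≠ 0 → P {y} ≠ 0 → (a n x).1 <+: (a n y).1 → a n x = a n y) :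
    shannon P (fun ω => restr 𝒩 fun n => a n ω) ≤
      Real.log q * ∑ n ∈ 𝒩, ∫ ω, ((a n ω).1.length : ℝ) ∂P := by
  classical
  have : NeZero q := ⟨by omega⟩
  have hq0 : (0 : ℝ) < q := by exact_mod_cast hq
  -- Gibbs' inequality is applied to the product of Kraft weights. Coordinates outside `𝒩` are
  -- constantly `none` and get the neutral weight `1`.
  let r' : Option (BoundedString q d) → ℝ := fun x => x.elim 1 fun l => (1 / (q : ℝ)) ^ l.1.length
  have hr' : ∀ x, 0 < r' x := by
    rintro (_ | l)
    · exact one_pos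
    · exact pow_pos (by positivity) _
  set f : Ω → ι → Option (BoundedString q d) := fun ω => restr 𝒩 fun n => a n ω with hf
  let S : ι → Finset (BoundedString q d) := fun n => {l : BoundedString q d | ∃ x, P {x} ≠ 0 ∧ a n x = l}
  let C : ι → Finset (Option (BoundedString q d)) := fun n => if n ∈ 𝒩 then (S n).image some else {none}
  have hC : ∀ n, ∑ x ∈ C n, r' x ≤ 1 := by
    intro n
    by_cases hn : n ∈ 𝒩
    · simp only [C, hn, if_true]
      rw [Finset.sum_image (by simp)]
      have hk := kraft_of_prefixFree ((S n).map (Function.Embedding.subtype _)) (by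
        simp only [Finset.mem_map, S, Finset.mem_filter, Finset.mem_univ, true_and]
        rintro _ ⟨_, ⟨x, hx, rfl⟩, rfl⟩ _ ⟨_, ⟨y, hy, rfl⟩, rfl⟩ hp
        exact congrArg _ (hpf n hn x y hx hy hp))
      rw [Finset.sum_map, Fintype.card_fin] at hk
      exact hk
    · simp only [C, hn, if_false, Finset.sum_singleton]
      exact le_rfl
  have hg := shannon_le_sum_mul_neg_log P f (fun x => ∏ n, r' (x n))
    (fun x => Finset.prod_pos fun n _ => hr' _) ?_
  · refine hg.trans (le_of_eq ?_)
    rw [← integral_comp_of_fintype P f fun x => -Real.log (∏ n, r' (x n))]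
    rw [← integral_finsetSum, ← integral_const_mul]
    · refine integral_congr_ae (.of_forall fun ω => ?_)
      simp only
      rw [Real.log_prod (fun n _ => (hr' _).ne'), Finset.mul_sum, ← Finset.sum_neg_distrib,
        ← Finset.sum_filter_add_sum_filter_not Finset.univ (· ∈ 𝒩)]
      simp only [Finset.filter_univ_mem]
      rw [Finset.sum_eq_zero (s := Finset.filter _ _), add_zero]
      · refine Finset.sum_congr rfl fun n hn => ?_
        simp only [hf, restr, hn, if_true, r', Option.elim]
        rw [Real.log_pow, one_div, Real.log_inv]
        ring
      · intro n hn
        simp only [hf, restr, (Finset.mem_filter.1 hn).2, if_false, r', Option.elim]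
        simp
    · intro n _
      refine Integrable.of_bound Measurable.of_discrete.aestronglyMeasurable d
        (.of_forall fun ω => ?_)
      simpa using (a n ω).2
  -- Values of positive probability lie in a product of prefix-free sets, so their total weight is
  -- at most a product of Kraft sums. No independence between the strings is needed.
  · have hsub : Finset.univ.filter (fun x => P.real (f ⁻¹' {x}) ≠ 0) ⊆ Fintype.piFinset C := by
      intro x hx
      rw [Finset.mem_filter] at hx
      have : ∃ ω ∈ f ⁻¹' {x}, P {ω} ≠ 0 := by
        by_contra! hc
        exact hx.2 (by simp [Measure.real,
          (measure_null_iff_singleton (Set.to_countable _)).2 hc])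
      obtain ⟨ω, hω, hP⟩ := this
      rw [Fintype.mem_piFinset]
      intro n
      rw [← show f ω = x from hω]
      by_cases hn : n ∈ 𝒩
      · simp only [hf, restr, hn, if_true, C, Finset.mem_image, S, Finset.mem_filter,
          Finset.mem_univ, true_and]
        exact ⟨_, ⟨ω, hP, rfl⟩, rfl⟩
      · simp [hf, restr, hn, C]
    refine (Finset.sum_le_sum_of_subset_of_nonneg hsub
      fun x _ _ => Finset.prod_nonneg fun n _ => (hr' _).le).trans ?_
    rw [← Finset.prod_univ_sum]
    exact Finset.prod_le_one (fun n _ => Finset.sum_nonneg fun x _ => (hr' x).le) fun n _ => hC n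

end Converse

/-! ### Entropy converse for one user -/

section Converse

set_option linter.unusedSectionVars false

variable {Ω α β γ ι : Type*} [MeasurableSpace Ω] [DiscreteMeasurableSpace Ω] [Countable Ω]
  (P : Measure Ω) [IsProbabilityMeasure P]

/-- The answers on `insert j σ` and on `τ` together amount to those on `insert j τ`, and `σ` is
common to both, so this is submodularity of entropy. -/
theorem shannon_restr_submodular [LinearOrder ι] [Fintype ι] [Fintype β] [Fintype γ]
    (a : ι → Ω → β) (c : Ω → γ) (σ τ : Finset ι) (j : ι) (h : σ ⊆ τ) :
    shannon P (fun s => (restr (insert j τ) (a · s), c s)) +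
        shannon P (fun s => (restr σ (a · s), c s)) ≤
      shannon P (fun s => (restr (insert j σ) (a · s), c s)) +
        shannon P (fun s => (restr τ (a · s), c s)) := by
  have hs := shannon_submodular P (fun s => restr (insert j σ) (a · s))
    (fun s => restr τ (a · s)) (fun s => (restr σ (a · s), c s))
  rw [shannon_congr P (fun ω => (restr (insert j σ) (a · ω), restr τ (a · ω),
      restr σ (a · ω), c ω)) (fun s => (restr (insert j τ) (a · s), c s)),
    shannon_congr P (fun ω => (restr (insert j σ) (a · ω), restr σ (a · ω), c ω))
      (fun s => (restr (insert j σ) (a · s), c s)),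
    shannon_congr P (fun ω => (restr τ (a · ω), restr σ (a · ω), c ω))
      (fun s => (restr τ (a · s), c s))] at hs
  · exact hs
  · intro x y _ _
    simp only [Prod.ext_iff, restr_eq_restr_iff]
    exact ⟨fun hh => ⟨hh.1, fun n hn => hh.1 n (h hn), hh.2⟩, fun hh => ⟨hh.1, hh.2.2⟩⟩
  · intro x y _ _
    simp only [Prod.ext_iff, restr_eq_restr_iff]
    exact ⟨fun hh => ⟨hh.1, fun n hn => hh.1 n (Finset.mem_insert_of_mem hn), hh.2⟩,
      fun hh => ⟨hh.1, hh.2.2⟩⟩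
  · intro x y _ _
    simp only [Prod.ext_iff, restr_eq_restr_iff, Finset.mem_insert]
    constructor
    · exact fun hh => ⟨fun n hn => hh.1 n (hn.imp id (@h n)), fun n hn => hh.1 n (.inr hn),
        fun n hn => hh.1 n (.inr (h hn)), hh.2⟩
    · refine fun hh => ⟨fun n hn => ?_, hh.2.2.2⟩
      rcases hn with hn | hn
      · exact hh.1 n (.inl hn)
      · exact hh.2.1 n hn

variable [Fintype α] [Nonempty α] {K : ℕ}

/-- The first `k` of `K` messages. -/
def firstMsgs (W : Fin K → Ω → α) (k : ℕ) (s : Ω) : Fin K → Option α :=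
  fun i => if (i : ℕ) < k then some (W i s) else none

theorem firstMsgs_eq_iff (W : Fin K → Ω → α) (k : ℕ) (s s' : Ω) :
    firstMsgs W k s = firstMsgs W k s' ↔ ∀ i : Fin K, (i : ℕ) < k → W i s = W i s' := by
  simp only [funext_iff, firstMsgs]
  refine forall_congr' fun n => ?_
  by_cases h : (n : ℕ) < k <;> simp [h]

theorem firstMsgs_succ_eq_iff (W : Fin K → Ω → α) (k : Fin K) (s s' : Ω) :
    firstMsgs W (k + 1) s = firstMsgs W (k + 1) s' ↔
      W k s = W k s' ∧ firstMsgs W k s = firstMsgs W k s' := by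
  simp only [firstMsgs_eq_iff]
  constructor
  · exact fun h => ⟨h k (Nat.lt_succ_self _), fun i hi => h i (hi.trans (Nat.lt_succ_self _))⟩
  · rintro ⟨h1, h2⟩ i hi
    rcases Nat.lt_succ_iff_lt_or_eq.1 hi with h | h
    · exact h2 i h
    · rw [Fin.ext h]; exact h1

theorem shannon_firstMsgs_succ_le (W : Fin K → Ω → α) (k : Fin K) :
    shannon P (firstMsgs W (k + 1)) ≤
      shannon P (firstMsgs W k) + Real.log (Fintype.card α) := by
  rw [shannon_congr P (firstMsgs W (k + 1)) (fun s => (W k s, firstMsgs W k s))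
    fun x y _ _ => by rw [firstMsgs_succ_eq_iff, Prod.ext_iff]]
  have h1 := shannon_prod_le_add P (W k) (firstMsgs W k)
  have h2 := shannon_le_log_card P (W k)
  linarith

/-- Each message adds at most `log |α|`. Counting up from `0` gives one inequality. Counting down
from all `K` messages, whose entropy is assumed maximal, gives the other. -/
theorem shannon_firstMsgs (W : Fin K → Ω → α)
    (hW : K * Real.log (Fintype.card α) ≤ shannon P (fun s i => W i s)) (k : ℕ) (hk : k ≤ K) :
    shannon P (firstMsgs W k) = k * Real.log (Fintype.card α) := by
  have up : ∀ k ≤ K, shannon P (firstMsgs W k) ≤ k * Real.log (Fintype.card α) := by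
    intro k
    induction k with
    | zero =>
      intro _
      have := shannon_le_log_card P (fun _ : Ω => ())
      rw [shannon_congr P (firstMsgs W 0) (fun _ => ()) (by simp [firstMsgs_eq_iff])]
      simpa using this
    | succ k ih =>
      intro hk
      have h1 := shannon_firstMsgs_succ_le P W ⟨k, hk⟩
      have h2 := ih (by omega)
      push_cast
      simp only at h1
      linarith
  have down : ∀ j k, k + j = K →
      k * Real.log (Fintype.card α) ≤ shannon P (firstMsgs W k) := by
    intro j
    induction j with
    | zero =>
      intro k hk
      rw [shannon_congr P (firstMsgs W k) (fun s i => W i s)]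
      · have hkK : (k : ℝ) = K := by exact_mod_cast hk
        rw [hkK]
        exact hW
      · intro x y _ _
        rw [firstMsgs_eq_iff, funext_iff]
        exact ⟨fun h i _ => h i, fun h i => h i (by omega)⟩
    | succ j ih =>
      intro k hk
      have h1 := shannon_firstMsgs_succ_le P W ⟨k, by omega⟩
      have h2 := ih (k + 1) (by omega)
      push_cast at h2
      simp only at h1
      linarith
  exact le_antisymm (up k hk) (down (K - k) k (by omega))

theorem integrable_shannon [Fintype γ] (ν : Measure ℕ) [IsProbabilityMeasure ν] (f : ℕ → Ω → γ) :
    Integrable (fun y => shannon P (f y)) ν := by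
  refine Integrable.of_bound Measurable.of_discrete.aestronglyMeasurable (Fintype.card γ)
    (.of_forall fun y => ?_)
  rw [Real.norm_eq_abs, abs_of_nonneg (shannon_nonneg P _)]
  exact shannon_le_card P _

/-- Converse for private information retrieval with one user, `t`-privacy and arbitrary storage:
the average joint entropy of the answers of the servers in `𝒩` is at least
`1 + ρ + ⋯ + ρ ^ (K - 1)` messages, where `ρ = t / |𝒩|`. -/
theorem log_card_mul_geom_sum_le_integral_shannon [LinearOrder ι] [Fintype ι] [Fintype β]
    (W : Fin K → Ω → α)
    (hW : K * Real.log (Fintype.card α) ≤ shannon P (fun s i => W i s))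
    (ν : Measure ℕ) [IsProbabilityMeasure ν] (Q : Fin K → ℕ → ι → ℕ) (a : ι → ℕ → Ω → β)
    (𝒩 : Finset ι) (t : ℕ) (ht : t < 𝒩.card)
    (privacy : ∀ τ : Finset ι, τ.card = t → ∀ k k',
      ν.map (fun y (n : τ) => Q k y n) = ν.map (fun y (n : τ) => Q k' y n))
    (correct : ∀ k y, ν {y} ≠ 0 → ∀ s s', P {s} ≠ 0 → P {s'} ≠ 0 →
      (∀ n ∈ 𝒩, a n (Q k y n) s = a n (Q k y n) s') → W k s = W k s')
    (k₀ : Fin K) (hk₀ : (k₀ : ℕ) = 0) :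
    Real.log (Fintype.card α) * ∑ j ∈ Finset.range K, ((t : ℝ) / 𝒩.card) ^ j ≤
      ∫ y, shannon P (fun s => restr 𝒩 fun n => a n (Q k₀ y n) s) ∂ν := by
  set lam := Real.log (Fintype.card α) with hlam
  have hlam0 : 0 ≤ lam := Real.log_nonneg (by exact_mod_cast Fintype.card_pos)
  have hn0 : (0 : ℝ) < 𝒩.card := by exact_mod_cast (Nat.zero_le t).trans_lt ht
  set ρ : ℝ := (t : ℝ) / 𝒩.card with hρ
  have hρ0 : 0 ≤ ρ := by positivity
  -- Average joint entropy of the answers of `τ` to a request for message `k` and of the first `c`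
  -- messages. It stands in for a conditional entropy, up to the known summand `c * lam`.
  let g : Finset ι → Fin K → ℕ → ℝ := fun τ k c =>
    ∫ y, shannon P (fun s => (restr τ (fun n => a n (Q k y n) s), firstMsgs W c s)) ∂ν
  have hint : ∀ (τ : Finset ι) (k : Fin K) (c : ℕ), Integrable (fun y =>
      shannon P (fun s => (restr τ (fun n => a n (Q k y n) s), firstMsgs W c s))) ν :=
    fun τ k c => integrable_shannon P ν _
  have g_decode : ∀ k : Fin K, g 𝒩 k k = g 𝒩 k (k + 1) := by
    intro k
    refine integral_congr_ae ((ae_iff_of_countable).2 fun y hy => ?_)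
    refine shannon_congr P _ _ fun x x' hx hx' => ?_
    simp only [Prod.ext_iff, restr_eq_restr_iff, firstMsgs_succ_eq_iff]
    exact ⟨fun h => ⟨h.1, h.2.2⟩, fun h => ⟨h.1, correct k y hy x x' hx hx' h.1, h.2⟩⟩
  have g_mono : ∀ τ ⊆ 𝒩, ∀ k c, g τ k c ≤ g 𝒩 k c := by
    intro τ hτ k c
    refine integral_mono (hint _ _ _) (hint _ _ _) fun y => ?_
    refine shannon_le_of_determines P _ _ fun x x' _ _ h => ?_
    simp only [Prod.ext_iff, restr_eq_restr_iff] at h ⊢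
    exact ⟨fun n hn => h.1 n (hτ hn), h.2⟩
  have g_empty : ∀ k c, g ∅ k c = shannon P (firstMsgs W c) := by
    intro k c
    have : ∀ y, shannon P (fun s => (restr ∅ (fun n => a n (Q k y n) s), firstMsgs W c s)) =
        shannon P (firstMsgs W c) := by
      intro y
      refine shannon_congr P _ _ fun x x' _ _ => ?_
      simp [Prod.ext_iff, restr_eq_restr_iff]
    simp only [g, this]
    simp
  have g_private : ∀ τ : Finset ι, τ.card = t → ∀ k k' c, g τ k c = g τ k' c := by
    intro τ hτ k k' c
    -- The entropy is expressed through the queries to `τ` alone, whose law is independent of `k`.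
    -- The default query `0` off `τ` is erased by `restr τ`.
    let F : (τ → ℕ) → ℝ := fun u => shannon P (fun s =>
      (restr τ (fun n => a n (if h : n ∈ τ then u ⟨n, h⟩ else 0) s), firstMsgs W c s))
    have hF : ∀ k, g τ k c = ∫ u, F u ∂(ν.map (fun y (n : τ) => Q k y n)) := by
      intro k
      rw [integral_map Measurable.of_discrete.aemeasurable
        (Measurable.of_discrete).aestronglyMeasurable]
      refine integral_congr_ae (.of_forall fun y => ?_)
      refine shannon_congr P _ _ fun x x' _ _ => ?_
      simp only [Prod.ext_iff, restr_eq_restr_iff]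
      refine and_congr_left fun _ => forall₂_congr fun n hn => ?_
      simp [hn]
    rw [hF, hF, privacy τ hτ k k']
  have g_submod : ∀ k c, ∀ σ τ : Finset ι, ∀ j, σ ⊆ τ →
      g (insert j τ) k c - g τ k c ≤ g (insert j σ) k c - g σ k c := by
    intro k c σ τ j h
    have : g (insert j τ) k c + g σ k c ≤ g (insert j σ) k c + g τ k c := by
      simp only [g]
      rw [← integral_add (hint _ _ _) (hint _ _ _), ← integral_add (hint _ _ _) (hint _ _ _)]
      refine integral_mono ((hint _ _ _).add (hint _ _ _)) ((hint _ _ _).add (hint _ _ _))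
        fun y => ?_
      exact shannon_restr_submodular P (fun n => a n (Q k y n)) (firstMsgs W c) σ τ j h
    linarith
  have hH : ∀ k ≤ K, shannon P (firstMsgs W k) = k * lam := shannon_firstMsgs P W hW
  -- Here `i` counts the messages after `k`. In the step, decode message `k`, pass to `t` servers,
  -- switch their request to `k + 1` by privacy, and return to all of `𝒩` at the price of a factor
  -- `ρ`.
  have main : ∀ i : ℕ, ∀ k : Fin K, (k : ℕ) + i + 1 = K →
      lam * ∑ j ∈ Finset.range (i + 1), ρ ^ j + (k : ℕ) * lam ≤ g 𝒩 k k := by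
    intro i
    induction i with
    | zero =>
      intro k hk
      have h1 := g_mono ∅ (Finset.empty_subset _) k (k + 1)
      rw [g_empty, hH _ (by omega)] at h1
      rw [g_decode]
      push_cast at h1
      simp only [zero_add, Finset.sum_range_one, pow_zero]
      linarith
    | succ i ih =>
      intro k hk
      have hk1 : (k : ℕ) + 1 < K := by omega
      obtain ⟨τ, hτ, hτc, hτs⟩ := exists_subset_card_mul_le_of_submodular
        (fun τ => g τ ⟨k + 1, hk1⟩ (k + 1)) (g_submod _ _) 𝒩 t ht.le
      have h1 := ih ⟨k + 1, hk1⟩ (by simp only; omega)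
      have h2 := g_mono τ hτ k (k + 1)
      rw [g_private τ hτc k ⟨k + 1, hk1⟩] at h2
      simp only [g_empty, hH _ hk1.le] at hτs
      rw [g_decode, Finset.sum_range_succ']
      set A := g 𝒩 ⟨k + 1, hk1⟩ (k + 1)
      set B := g τ ⟨k + 1, hk1⟩ (k + 1)
      have h3 : ρ * (A - ((k + 1 : ℕ) : ℝ) * lam) ≤ B - ((k + 1 : ℕ) : ℝ) * lam := by
        rw [hρ, div_mul_eq_mul_div, div_le_iff₀ hn0]
        linarith
      have h4 : ρ * (lam * ∑ j ∈ Finset.range (i + 1), ρ ^ j) ≤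
          ρ * (A - ((k + 1 : ℕ) : ℝ) * lam) := by
        refine mul_le_mul_of_nonneg_left ?_ hρ0
        simp only at h1
        linarith
      simp_rw [pow_succ, ← Finset.sum_mul]
      push_cast at h3 h4
      simp only [pow_zero]
      linarith
  have h := main (K - 1) k₀ (by have := k₀.2; omega)
  have e : K - 1 + 1 = K := by have := k₀.2; omega
  rw [e, hk₀] at h
  simp only [Nat.cast_zero, zero_mul, add_zero] at h
  refine h.trans (integral_mono (hint _ _ _) (integrable_shannon P ν _) fun y => ?_)
  refine shannon_le_of_determines P _ _ fun x x' _ _ h => ?_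
  simp only [Prod.ext_iff, firstMsgs_eq_iff]
  exact ⟨h, by simp⟩

end Converse

/-! ### Converse with secure storage -/

section SingleUser

theorem shannon_of_uniform {Ω α : Type*} [MeasurableSpace Ω] [Fintype α] (P : Measure Ω)
    (f : Ω → α) (h : ∀ a, P.real (f ⁻¹' {a}) = (Fintype.card α : ℝ)⁻¹) :
    shannon P f = Real.log (Fintype.card α) := by
  rw [shannon]
  simp_rw [h]
  rw [Finset.sum_const, Finset.card_univ, nsmul_eq_mul, Real.negMulLog, Real.log_inv]
  rcases eq_or_ne (Fintype.card α : ℝ) 0 with h0 | h0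
  · simp [h0]
  · field_simp

theorem cond_singleton_ne_zero {Ω : Type*} [MeasurableSpace Ω] [DiscreteMeasurableSpace Ω]
    {P : Measure Ω} {E : Set Ω} {x : Ω} (h : P[|E] {x} ≠ 0) : x ∈ E ∧ P {x} ≠ 0 := by
  rw [cond_apply .of_discrete] at h
  have h1 : P (E ∩ {x}) ≠ 0 := fun h0 => h (by rw [h0, mul_zero])
  refine ⟨?_, fun h0 => h1 (measure_mono_null Set.inter_subset_right h0)⟩
  by_contra hx
  exact h1 (by rw [Set.inter_singleton_eq_empty.2 hx, measure_empty])

variable {N K q d : ℕ} {α : Type*} [Fintype α] [Nonempty α]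
  (P : Measure (Fin N → ℕ)) [IsProbabilityMeasure P] (ν : Measure ℕ) [IsProbabilityMeasure ν]
  (W : Fin K → (Fin N → ℕ) → α) (Q : Fin K → ℕ → Fin N → ℕ)
  (a : Fin N → ℕ → ℕ → List (Fin q))

/-- Converse for `t`-private information retrieval from secure storage: the servers in the
complement of a set `𝒳` whose content is independent of the messages return, on average, at
least `1 + ρ + ⋯ + ρ ^ (K - 1)` messages. -/
theorem log_card_mul_geom_sum_le_of_secure (hq : 1 ≤ q) (𝒳 : Finset (Fin N)) (t : ℕ)
    (ht : 𝒳.card + t < N)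
    (security : ∀ (x : 𝒳 → ℕ) (b : Fin K → α),
      P.real {s | (∀ n : 𝒳, s n = x n) ∧ ∀ k, W k s = b k} =
        P.real {s | ∀ n : 𝒳, s n = x n} * ((Fintype.card α : ℝ) ^ K)⁻¹)
    (privacy : ∀ τ : Finset (Fin N), τ.card = t → ∀ k k',
      ν.map (fun y (n : τ) => Q k y n) = ν.map (fun y (n : τ) => Q k' y n))
    (correct : ∀ k y, ν {y} ≠ 0 → ∀ s s', P {s} ≠ 0 → P {s'} ≠ 0 →
      (∀ n, a n (Q k y n) (s n) = a n (Q k y n) (s' n)) → W k s = W k s')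
    (length : ∀ k y, ν {y} ≠ 0 → ∀ s, P {s} ≠ 0 →
      ∑ n, (a n (Q k y n) (s n)).length ≤ d)
    (prefixFree : ∀ k y, ν {y} ≠ 0 → ∀ s s', P {s} ≠ 0 → P {s'} ≠ 0 → ∀ n,
      a n (Q k y n) (s n) <+: a n (Q k y n) (s' n) →
        a n (Q k y n) (s n) = a n (Q k y n) (s' n))
    (k₀ : Fin K) (hk₀ : (k₀ : ℕ) = 0) :
    Real.log (Fintype.card α) *
        ∑ j ∈ Finset.range K, ((t : ℝ) / ((N - 𝒳.card : ℕ) : ℝ)) ^ j ≤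
      ∫ s, Real.log q *
        ∑ n ∈ 𝒳ᶜ, ∫ y, (((a n (Q k₀ y n) (s n)).take d).length : ℝ) ∂ν ∂P := by
  classical
  set c := Real.log (Fintype.card α) *
    ∑ j ∈ Finset.range K, ((t : ℝ) / ((N - 𝒳.card : ℕ) : ℝ)) ^ j with hc
  set Λ : (Fin N → ℕ) → ℝ := fun s => Real.log q *
    ∑ n ∈ 𝒳ᶜ, ∫ y, (((a n (Q k₀ y n) (s n)).take d).length : ℝ) ∂ν with hΛ
  have hcard : 𝒳ᶜ.card = N - 𝒳.card := by rw [Finset.card_compl, Fintype.card_fin]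
  have hlen0 : ∀ l : List (Fin q), ((l.take d).length : ℝ) ≤ d := fun l => by
    exact_mod_cast List.length_take_le d l
  have hmeas : ∀ (n : Fin N) (s : Fin N → ℕ),
      |∫ y, (((a n (Q k₀ y n) (s n)).take d).length : ℝ) ∂ν| ≤ d := by
    intro n s
    have := norm_integral_le_of_norm_le_const (μ := ν)
      (f := fun y => (((a n (Q k₀ y n) (s n)).take d).length : ℝ)) (C := d)
      (.of_forall fun y => by
        rw [Real.norm_eq_abs, abs_of_nonneg (Nat.cast_nonneg _)]
        exact hlen0 _)
    simpa using this
  have hint1 : ∀ (P' : Measure (Fin N → ℕ)) [IsFiniteMeasure P'] (n : Fin N), Integrable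
      (fun s : Fin N → ℕ => ∫ y, (((a n (Q k₀ y n) (s n)).take d).length : ℝ) ∂ν) P' := by
    intro P' _ n
    exact Integrable.of_bound Measurable.of_discrete.aestronglyMeasurable d
      (.of_forall fun s => hmeas n s)
  have hΛint : ∀ (P' : Measure (Fin N → ℕ)) [IsFiniteMeasure P'], Integrable Λ P' := fun P' _ =>
    (integrable_finsetSum _ fun n _ => hint1 P' n).const_mul _
  let E : (𝒳 → ℕ) → Set (Fin N → ℕ) := fun x => {s | ∀ n : 𝒳, s n = x n}
  -- The bound is proved conditionally on each content `x` of the servers in `𝒳`. The countably many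
  -- slices are then added.
  have hstep : ∀ x : 𝒳 → ℕ, 0 ≤ ∫ s in E x, (Λ s - c) ∂P := by
    intro x
    by_cases hx : P (E x) = 0
    · rw [Measure.restrict_eq_zero.2 hx, integral_zero_measure]
    have hP' : IsProbabilityMeasure (P[|E x]) := cond_isProbabilityMeasure hx
    set P' := P[|E x] with hP'def
    have hsupp : ∀ s, P' {s} ≠ 0 → s ∈ E x ∧ P {s} ≠ 0 := fun s hs => cond_singleton_ne_zero hs
    have hW : K * Real.log (Fintype.card α) ≤ shannon P' (fun s i => W i s) := by
      rw [shannon_of_uniform]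
      · rw [Fintype.card_fun, Fintype.card_fin, Nat.cast_pow, Real.log_pow]
      · intro b
        have h1 := security x b
        have h2 : P.real (E x) ≠ 0 := by
          rw [Measure.real, ENNReal.toReal_ne_zero]
          exact ⟨hx, measure_ne_top _ _⟩
        rw [Measure.real, cond_apply .of_discrete, ENNReal.toReal_mul, ENNReal.toReal_inv,
          ← Measure.real, ← Measure.real, Fintype.card_fun, Fintype.card_fin, Nat.cast_pow]
        have h3 : E x ∩ (fun s i => W i s) ⁻¹' {b} =
            {s | (∀ n : 𝒳, s n = x n) ∧ ∀ k, W k s = b k} := by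
          ext s; simp [E, funext_iff]
        rw [h3, h1]
        change (P.real (E x))⁻¹ * (P.real (E x) * _) = _
        rw [inv_mul_cancel_left₀ h2]
    -- Truncation at `d` makes the alphabet finite and the lengths integrable. On realizations of
    -- positive probability it changes nothing.
    let A : Fin N → ℕ → (Fin N → ℕ) → BoundedString q d := fun n v s =>
      ⟨(a n v (s n)).take d, List.length_take_le _ _⟩
    have hA : ∀ k y, ν {y} ≠ 0 → ∀ s, P' {s} ≠ 0 → ∀ n,
        (A n (Q k y n) s).1 = a n (Q k y n) (s n) := by
      intro k y hy s hs n
      refine List.take_of_length_le ((Finset.single_le_sum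
        (f := fun n => (a n (Q k y n) (s n)).length) (fun _ _ => Nat.zero_le _)
        (Finset.mem_univ n)).trans (length k y hy s (hsupp s hs).2))
    have core := log_card_mul_geom_sum_le_integral_shannon P' W hW ν Q A 𝒳ᶜ t
      (by rw [hcard]; omega) privacy (by
        intro k y hy s s' hs hs' h
        refine correct k y hy s s' (hsupp s hs).2 (hsupp s' hs').2 fun n => ?_
        by_cases hn : n ∈ 𝒳
        -- Servers in `𝒳` have constant content on this slice, so their answers are fixed by the
        -- query and are not needed for decoding.
        · rw [(hsupp s hs).1 ⟨n, hn⟩, (hsupp s' hs').1 ⟨n, hn⟩]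
        · rw [← hA k y hy s hs, ← hA k y hy s' hs', h n (by simpa using hn)]) k₀ hk₀
    rw [hcard, ← hc] at core
    have hcode : ∫ y, shannon P' (fun s => restr 𝒳ᶜ fun n => A n (Q k₀ y n) s) ∂ν ≤
        ∫ y, Real.log q * ∑ n ∈ 𝒳ᶜ, ∫ s, ((A n (Q k₀ y n) s).1.length : ℝ) ∂P' ∂ν := by
      refine integral_mono_ae (integrable_shannon P' ν _) ?_
        ((ae_iff_of_countable).2 fun y hy => ?_)
      · refine (integrable_finsetSum _ fun n _ => ?_).const_mul _
        refine Integrable.of_bound Measurable.of_discrete.aestronglyMeasurable d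
          (.of_forall fun y => ?_)
        have := norm_integral_le_of_norm_le_const (μ := P')
          (f := fun s => ((A n (Q k₀ y n) s).1.length : ℝ)) (C := d)
          (.of_forall fun s => by simpa using (A n (Q k₀ y n) s).2)
        simpa using this
      · refine shannon_restr_le_length P' hq 𝒳ᶜ (fun n => A n (Q k₀ y n))
          fun n _ s s' hs hs' hp => ?_
        rw [Subtype.ext_iff]
        rw [hA k₀ y hy s hs, hA k₀ y hy s' hs'] at hp ⊢
        exact prefixFree k₀ y hy s s' (hsupp s hs).2 (hsupp s' hs').2 n hp
    have hswap : ∫ y, Real.log q * ∑ n ∈ 𝒳ᶜ, ∫ s, ((A n (Q k₀ y n) s).1.length : ℝ) ∂P' ∂ν =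
        ∫ s, Λ s ∂P' := by
      simp only [hΛ]
      rw [integral_const_mul, integral_const_mul]
      congr 1
      rw [integral_finsetSum, integral_finsetSum]
      · refine Finset.sum_congr rfl fun n _ => ?_
        rw [integral_integral_swap]
        refine Integrable.of_bound Measurable.of_discrete.aestronglyMeasurable d
          (.of_forall fun p => ?_)
        simpa [Function.uncurry] using (A n (Q k₀ p.1 n) p.2).2
      · exact fun n _ => hint1 P' n
      · intro n _
        refine Integrable.of_bound Measurable.of_discrete.aestronglyMeasurable d
          (.of_forall fun y => ?_)
        have := norm_integral_le_of_norm_le_const (μ := P')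
          (f := fun s => ((A n (Q k₀ y n) s).1.length : ℝ)) (C := d)
          (.of_forall fun s => by simpa using (A n (Q k₀ y n) s).2)
        simpa using this
    have h0 : 0 ≤ ∫ s, (Λ s - c) ∂P' := by
      rw [integral_sub (hΛint P') (integrable_const c)]
      simp only [integral_const, probReal_univ, one_smul]
      linarith
    rw [hP'def, ProbabilityTheory.cond, integral_smul_measure] at h0
    refine nonneg_of_mul_nonneg_right h0 ?_
    refine ENNReal.toReal_pos ?_ ?_
    · simp
    · simpa using hx
  have hU : ⋃ x, E x = Set.univ := by
    ext s
    simp only [Set.mem_iUnion, Set.mem_univ, iff_true]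
    exact ⟨fun n => s n, fun n => rfl⟩
  have hdisj : Pairwise (Function.onFun Disjoint E) := by
    intro x x' hxx
    refine Set.disjoint_left.2 fun s hs hs' => hxx ?_
    funext n
    rw [← hs n, hs' n]
  have hsum := hasSum_integral_iUnion (μ := P) (f := fun s => Λ s - c)
    (fun x => (MeasurableSet.of_discrete : MeasurableSet (E x))) hdisj
    ((hΛint _).sub (integrable_const c)).integrableOn
  rw [hU, setIntegral_univ] at hsum
  have := hsum.nonneg hstep
  rw [integral_sub (hΛint P) (integrable_const c)] at this
  simp only [integral_const, probReal_univ, one_smul] at this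
  linarith

/-- Converse for `X`-secure `t`-private information retrieval: bound on the maximal download. -/
theorem log_card_mul_geom_sum_mul_le_download (hq : 1 ≤ q) (X t : ℕ) (ht : X + t < N)
    (security : ∀ 𝒳 : Finset (Fin N), 𝒳.card = X → ∀ (x : 𝒳 → ℕ) (b : Fin K → α),
      P.real {s | (∀ n : 𝒳, s n = x n) ∧ ∀ k, W k s = b k} =
        P.real {s | ∀ n : 𝒳, s n = x n} * ((Fintype.card α : ℝ) ^ K)⁻¹)
    (privacy : ∀ τ : Finset (Fin N), τ.card = t → ∀ k k',
      ν.map (fun y (n : τ) => Q k y n) = ν.map (fun y (n : τ) => Q k' y n))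
    (correct : ∀ k y, ν {y} ≠ 0 → ∀ s s', P {s} ≠ 0 → P {s'} ≠ 0 →
      (∀ n, a n (Q k y n) (s n) = a n (Q k y n) (s' n)) → W k s = W k s')
    (length : ∀ k y, ν {y} ≠ 0 → ∀ s, P {s} ≠ 0 →
      ∑ n, (a n (Q k y n) (s n)).length ≤ d)
    (prefixFree : ∀ k y, ν {y} ≠ 0 → ∀ s s', P {s} ≠ 0 → P {s'} ≠ 0 → ∀ n,
      a n (Q k y n) (s n) <+: a n (Q k y n) (s' n) →
        a n (Q k y n) (s n) = a n (Q k y n) (s' n))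
    (hK : 1 ≤ K) :
    N * (Real.log (Fintype.card α) *
        ∑ j ∈ Finset.range K, ((t : ℝ) / ((N : ℝ) - X)) ^ j) ≤
      ((N : ℝ) - X) * (Real.log q * d) := by
  classical
  let k₀ : Fin K := ⟨0, hK⟩
  let ℓ : Fin N → ℝ := fun n =>
    ∫ s : Fin N → ℕ, ∫ y, (((a n (Q k₀ y n) (s n)).take d).length : ℝ) ∂ν ∂P
  have hNX : ((N - X : ℕ) : ℝ) = (N : ℝ) - X := Nat.cast_sub (by omega)
  have hb : ∀ (n : Fin N) (s : Fin N → ℕ), Integrable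
      (fun y => (((a n (Q k₀ y n) (s n)).take d).length : ℝ)) ν := fun n s =>
    Integrable.of_bound Measurable.of_discrete.aestronglyMeasurable d
      (.of_forall fun y => by
        have := List.length_take_le d (a n (Q k₀ y n) (s n))
        rw [Real.norm_eq_abs, abs_of_nonneg (Nat.cast_nonneg _)]
        exact_mod_cast this)
  have hi : ∀ n : Fin N, Integrable
      (fun s : Fin N → ℕ => ∫ y, (((a n (Q k₀ y n) (s n)).take d).length : ℝ) ∂ν) P := by
    intro n
    refine Integrable.of_bound Measurable.of_discrete.aestronglyMeasurable d
      (.of_forall fun s => ?_)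
    have := norm_integral_le_of_norm_le_const (μ := ν)
      (f := fun y => (((a n (Q k₀ y n) (s n)).take d).length : ℝ)) (C := d)
      (.of_forall fun y => by
        have := List.length_take_le d (a n (Q k₀ y n) (s n))
        rw [Real.norm_eq_abs, abs_of_nonneg (Nat.cast_nonneg _)]
        exact_mod_cast this)
    simpa using this
  -- Exclude `X` servers carrying at least the share `X / N` of the expected download. The others
  -- then carry at most `(N - X) / N` of it.
  obtain ⟨τ, -, hτc, hτs⟩ := exists_subset_card_mul_sum_le (Finset.univ : Finset (Fin N)) ℓ X
    (by simp; omega)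
  have h1 := log_card_mul_geom_sum_le_of_secure P ν W Q a hq τ t (by omega) (security τ hτc)
    privacy correct length prefixFree k₀ rfl
  rw [integral_const_mul, integral_finsetSum _ fun n _ => hi n, hτc, hNX] at h1
  change _ ≤ Real.log q * ∑ n ∈ τᶜ, ℓ n at h1
  have htot : ∑ n, ℓ n ≤ d := by
    have e : ∑ n, ℓ n =
        ∫ s : Fin N → ℕ, ∫ y, ∑ n, (((a n (Q k₀ y n) (s n)).take d).length : ℝ) ∂ν ∂P := by
      simp only [ℓ]
      rw [← integral_finsetSum _ fun n _ => hi n]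
      refine integral_congr_ae (.of_forall fun s => ?_)
      simp only
      rw [integral_finsetSum _ fun n _ => hb n s]
    rw [e]
    have h2 : ∀ s, P {s} ≠ 0 →
        ∫ y, ∑ n, (((a n (Q k₀ y n) (s n)).take d).length : ℝ) ∂ν ≤ d := by
      intro s hs
      calc ∫ y, ∑ n, (((a n (Q k₀ y n) (s n)).take d).length : ℝ) ∂ν ≤ ∫ _y, (d : ℝ) ∂ν := by
            refine integral_mono_ae (integrable_finsetSum _ fun n _ => hb n s)
              (integrable_const _) (ae_iff_of_countable.2 fun y hy => ?_)
            have := length k₀ y hy s hs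
            have h3 : ∑ n, ((a n (Q k₀ y n) (s n)).take d).length ≤ d :=
              (Finset.sum_le_sum fun n _ => List.length_take_le' _ _).trans this
            simp only
            exact_mod_cast h3
        _ = d := by simp
    calc _ ≤ ∫ _s, (d : ℝ) ∂P := by
          refine integral_mono_ae ?_ (integrable_const _) (ae_iff_of_countable.2 h2)
          have := integrable_finsetSum (Finset.univ) fun n _ => hi n
          refine this.congr (.of_forall fun s => ?_)
          simp only
          rw [integral_finsetSum _ fun n _ => hb n s]
      _ = d := by simp
  have hlq : 0 ≤ Real.log q := Real.log_nonneg (by exact_mod_cast hq)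
  have hsplit : ∑ n ∈ τᶜ, ℓ n = ∑ n, ℓ n - ∑ n ∈ τ, ℓ n := by
    rw [← Finset.sum_add_sum_compl τ]; ring
  rw [Finset.card_univ, Fintype.card_fin] at hτs
  have hXN : (0 : ℝ) ≤ (N : ℝ) - X := by rw [← hNX]; positivity
  calc _ ≤ (N : ℝ) * (Real.log q * ∑ n ∈ τᶜ, ℓ n) :=
        mul_le_mul_of_nonneg_left h1 (Nat.cast_nonneg _)
    _ = Real.log q * (N * ∑ n, ℓ n - N * ∑ n ∈ τ, ℓ n) := by rw [hsplit]; ring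
    _ ≤ Real.log q * (((N : ℝ) - X) * ∑ n, ℓ n) := by
        refine mul_le_mul_of_nonneg_left ?_ hlq
        linarith
    _ ≤ Real.log q * (((N : ℝ) - X) * d) := by gcongr
    _ = _ := by ring

end SingleUser

instance (q : ℕ) : DiscreteMeasurableSpace (QString q) := ⟨fun _ => trivial⟩

instance (q : ℕ) : Countable (QString q) := inferInstanceAs (Countable (List (Fin q)))

/-! ### Functional dependence and independence from vanishing information -/

section Extraction

variable {Ω α β γ : Type*} [MeasurableSpace Ω] {μ : Measure Ω} [IsProbabilityMeasure μ]

theorem exists_measure_fiber_ne_zero [Countable α] (A : Ω → α) : ∃ a, μ (A ⁻¹' {a}) ≠ 0 := by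
  by_contra! h
  have : μ (⋃ a, A ⁻¹' {a}) = 0 := measure_iUnion_null h
  have hU : ⋃ a, A ⁻¹' {a} = Set.univ := by ext; simp
  rw [hU, measure_univ] at this
  exact one_ne_zero this

/-- `negMulLog` is strictly positive on the open unit interval, so a fibre of positive mass has full
mass. -/
theorem measure_fiber_eq_one_of_entropy_eq_zero {A : Ω → α} (h : entropy μ A = 0) {a : α}
    (ha : μ (A ⁻¹' {a}) ≠ 0) : μ (A ⁻¹' {a}) = 1 := by
  rw [entropy, ENNReal.tsum_eq_zero] at h
  have h1 := ENNReal.ofReal_eq_zero.1 (h a)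
  have hpos : 0 < μ.real (A ⁻¹' {a}) := ENNReal.toReal_pos ha (measure_ne_top _ _)
  have h2 : ¬ μ.real (A ⁻¹' {a}) < 1 := by
    intro hlt
    have := mul_pos_of_neg_of_neg (neg_neg_of_pos hpos) (Real.log_neg hpos hlt)
    rw [Real.negMulLog] at h1
    linarith
  have h3 : μ.real (A ⁻¹' {a}) = 1 := le_antisymm measureReal_le_one (not_lt.1 h2)
  rw [Measure.real, ENNReal.toReal_eq_one_iff] at h3
  exact h3

/-- A variable of zero conditional entropy is almost surely a function of the condition. -/
theorem exists_ae_eq_of_condEntropy_eq_zero [Countable α] [MeasurableSpace α]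
    [DiscreteMeasurableSpace α] [Countable β] [MeasurableSpace β] [DiscreteMeasurableSpace β]
    {A : Ω → α} {B : Ω → β} (hA : Measurable A) (hB : Measurable B)
    (h : condEntropy μ A B = 0) : ∃ g : β → α, ∀ᵐ ω ∂μ, A ω = g (B ω) := by
  rw [condEntropy, ENNReal.tsum_eq_zero] at h
  have hΩ : Nonempty Ω := nonempty_of_isProbabilityMeasure μ
  have key : ∀ b, ∃ a, ∀ᵐ ω ∂μ, B ω = b → A ω = a := by
    intro b
    by_cases hb : μ (B ⁻¹' {b}) = 0
    · refine ⟨A (Classical.arbitrary Ω), ?_⟩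
      filter_upwards [measure_eq_zero_iff_ae_notMem.1 hb] with ω hω hB
      exact absurd hB hω
    · have := cond_isProbabilityMeasure hb
      have he := (mul_eq_zero.1 (h b)).resolve_left hb
      obtain ⟨a, ha⟩ := exists_measure_fiber_ne_zero (μ := μ[|B ⁻¹' {b}]) A
      have h1 := measure_fiber_eq_one_of_entropy_eq_zero he ha
      refine ⟨a, ?_⟩
      have h2 : μ[|B ⁻¹' {b}] (A ⁻¹' {a})ᶜ = 0 :=
        (prob_compl_eq_zero_iff (hA .of_discrete)).2 h1
      rw [cond_apply (hB .of_discrete), mul_eq_zero] at h2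
      have h3 := h2.resolve_left (by simp)
      filter_upwards [measure_eq_zero_iff_ae_notMem.1 h3] with ω hω hB
      by_contra hne
      exact hω ⟨hB, hne⟩
  choose g hg using key
  refine ⟨g, ?_⟩
  filter_upwards [ae_all_iff.2 hg] with ω hω
  exact hω _ rfl

theorem map_prod_eq_of_mutualInfo_eq_zero [MeasurableSpace α] [MeasurableSpace β] {A : Ω → α}
    {B : Ω → β} (hA : Measurable A) (hB : Measurable B) (h : mutualInfo μ A B = 0) :
    μ.map (fun ω => (A ω, B ω)) = (μ.map A).prod (μ.map B) := by
  have := Measure.isProbabilityMeasure_map (μ := μ) hA.aemeasurable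
  have := Measure.isProbabilityMeasure_map (μ := μ) hB.aemeasurable
  exact InformationTheory.klDiv_eq_zero_iff.1 h

theorem measure_inter_eq_mul_of_mutualInfo_eq_zero [MeasurableSpace α] [MeasurableSpace β]
    {A : Ω → α} {B : Ω → β} (hA : Measurable A) (hB : Measurable B) (h : mutualInfo μ A B = 0)
    {s : Set α} {t : Set β} (hs : MeasurableSet s) (ht : MeasurableSet t) :
    μ (A ⁻¹' s ∩ B ⁻¹' t) = μ (A ⁻¹' s) * μ (B ⁻¹' t) := by
  have := Measure.isProbabilityMeasure_map (μ := μ) hA.aemeasurable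
  have := Measure.isProbabilityMeasure_map (μ := μ) hB.aemeasurable
  have h1 := congrArg (fun ν => ν (s ×ˢ t)) (map_prod_eq_of_mutualInfo_eq_zero hA hB h)
  simp only [Measure.prod_prod] at h1
  rw [Measure.map_apply (hA.prodMk hB) (hs.prod ht), Measure.map_apply hA hs,
    Measure.map_apply hB ht] at h1
  exact h1

/-- Coordinates in the image of `j` are prescribed and the others are free. It yields uniformity of
the subfamily of messages seen by a single user. -/
theorem card_comp_eq_mul {κ J : Type*} [Fintype κ] [Fintype J] [DecidableEq J] [Fintype α]
    [DecidableEq α] (j : κ → J) (hj : Function.Injective j) (b : κ → α) :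
    (Finset.univ.filter fun D : J → α => ∀ k, D (j k) = b k).card * Fintype.card α ^
      Fintype.card κ = Fintype.card α ^ Fintype.card J := by
  classical
  have h1 : (Finset.univ.filter fun D : J → α => ∀ k, D (j k) = b k) =
      Fintype.piFinset fun i => Finset.univ.filter fun c => ∀ k, j k = i → c = b k := by
    ext D
    simp only [Finset.mem_filter, Finset.mem_univ, true_and, Fintype.mem_piFinset]
    exact ⟨fun h i k hk => hk ▸ h k, fun h k => h _ k rfl⟩
  have h2 : ∀ i, (Finset.univ.filter fun c => ∀ k, j k = i → c = b k).card =
      if i ∈ Finset.univ.image j then 1 else Fintype.card α := by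
    intro i
    split_ifs with hi
    · obtain ⟨k, -, rfl⟩ := Finset.mem_image.1 hi
      rw [Finset.card_eq_one]
      refine ⟨b k, ?_⟩
      ext c
      simp only [Finset.mem_filter, Finset.mem_univ, true_and, Finset.mem_singleton]
      exact ⟨fun h => h k rfl, fun h k' hk' => by rw [hj hk', h]⟩
    · rw [Finset.filter_true_of_mem, Finset.card_univ]
      intro c _ k hk
      exact absurd (Finset.mem_image.2 ⟨k, Finset.mem_univ _, hk⟩) hi
  rw [h1, Fintype.card_piFinset]
  simp_rw [h2]
  rw [Finset.prod_ite, Finset.prod_const_one, one_mul, Finset.prod_const, ← pow_add]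
  congr 1
  have h3 : Finset.univ.filter (fun i => i ∉ Finset.univ.image j) = (Finset.univ.image j)ᶜ := by
    ext; simp
  rw [h3, Finset.card_compl, Finset.card_image_of_injective _ hj, Finset.card_univ]
  exact Nat.sub_add_cancel (Fintype.card_le_of_injective j hj)

theorem uniformOn_univ_comp {κ J : Type*} [Fintype κ] [Fintype J] [DecidableEq J] [Fintype α]
    [Nonempty α] [MeasurableSpace (J → α)] [MeasurableSingletonClass (J → α)]
    (j : κ → J) (hj : Function.Injective j) (b : κ → α) :
    uniformOn (Set.univ : Set (J → α)) {D | ∀ k, D (j k) = b k} =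
      ((Fintype.card α : ℝ≥0∞) ^ Fintype.card κ)⁻¹ := by
  classical
  have h := card_comp_eq_mul j hj b
  have h0 : (Fintype.card α : ℝ≥0∞) ≠ 0 := by simp
  have h1 : (Fintype.card α : ℝ≥0∞) ≠ ⊤ := by simp
  have hset : {D : J → α | ∀ k, D (j k) = b k} =
      (Finset.univ.filter fun D : J → α => ∀ k, D (j k) = b k : Finset (J → α)) := by ext; simp
  rw [uniformOn_univ, hset, Measure.count_apply_finset]
  rw [Fintype.card_fun, ← h, Nat.cast_mul, Nat.cast_pow, div_eq_mul_inv]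
  have hc : ((Finset.univ.filter fun D : J → α => ∀ k, D (j k) = b k).card : ℝ≥0∞) ≠ 0 := by
    rw [Nat.cast_ne_zero]
    rintro hz
    rw [hz, zero_mul] at h
    exact (pow_pos Fintype.card_pos _).ne h
  rw [ENNReal.mul_inv (.inl hc) (.inl (by simp)), ← mul_assoc,
    ENNReal.mul_inv_cancel hc (by simp), one_mul]

end Extraction

-- Reduction of a scheme to a single user

attribute [instance] Scheme.measΩ Scheme.prob

namespace Scheme

variable {q L M N X : ℕ} {K T : Fin M → ℕ} (s : Scheme q L N X K T)

/-- The independent variables on which a scheme is built: storage, common randomness, indices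
and private randomness. -/
def source (ω : s.Ω) : (Fin N → ℕ) × ℕ × ((m : Fin M) → Fin (K m)) × (Fin M → ℕ) :=
  (fun n => s.S n ω, s.Zc ω, fun m => s.θ m ω, fun m => s.Z m ω)

theorem measurable_source : Measurable s.source :=
  (measurable_pi_lambda _ s.measurable_S).prodMk (s.measurable_Zc.prodMk
    ((measurable_pi_lambda _ s.measurable_θ).prodMk (measurable_pi_lambda _ s.measurable_Z)))

theorem isProbabilityMeasure_map_θ (m : Fin M) : IsProbabilityMeasure (s.μ.map (s.θ m)) :=
  Measure.isProbabilityMeasure_map (s.measurable_θ m).aemeasurable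

theorem isProbabilityMeasure_map_Z (m : Fin M) : IsProbabilityMeasure (s.μ.map (s.Z m)) :=
  Measure.isProbabilityMeasure_map (s.measurable_Z m).aemeasurable

theorem isProbabilityMeasure_map_S :
    IsProbabilityMeasure (s.μ.map fun ω n => s.S n ω) :=
  Measure.isProbabilityMeasure_map (measurable_pi_lambda _ s.measurable_S).aemeasurable

theorem isProbabilityMeasure_map_Zc : IsProbabilityMeasure (s.μ.map s.Zc) :=
  Measure.isProbabilityMeasure_map s.measurable_Zc.aemeasurable

theorem measure_θ_ne_zero (m : Fin M) (k : Fin (K m)) : s.μ (s.θ m ⁻¹' {k}) ≠ 0 := by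
  rw [← Measure.map_apply (s.measurable_θ m) (measurableSet_singleton k), s.uniform_θ m,
    uniformOn_univ]
  simp

/-- Independence makes this a product of positive masses. It is what permits freezing some
components while the others range over all their atoms. -/
theorem measure_source_ne_zero (c : Fin N → ℕ) (z : ℕ) (t : (m : Fin M) → Fin (K m))
    (y : Fin M → ℕ) (hc : s.μ.map (fun ω n => s.S n ω) {c} ≠ 0) (hz : s.μ.map s.Zc {z} ≠ 0)
    (hy : ∀ m, s.μ.map (s.Z m) {y m} ≠ 0) : s.μ (s.source ⁻¹' {(c, z, t, y)}) ≠ 0 := by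
  have := s.isProbabilityMeasure_map_θ
  have := s.isProbabilityMeasure_map_Z
  have := s.isProbabilityMeasure_map_S
  have := s.isProbabilityMeasure_map_Zc
  rw [← Measure.map_apply s.measurable_source (measurableSet_singleton _)]
  have h := s.independent
  change s.μ.map s.source = _ at h
  rw [h, ← Set.singleton_prod_singleton, ← Set.singleton_prod_singleton,
    ← Set.singleton_prod_singleton, Measure.prod_prod, Measure.prod_prod, Measure.prod_prod,
    Measure.pi_singleton, Measure.pi_singleton]
  refine mul_ne_zero hc (mul_ne_zero hz (mul_ne_zero ?_ (Finset.prod_ne_zero_iff.2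
    fun m _ => hy m)))
  refine Finset.prod_ne_zero_iff.2 fun m _ => ?_
  rw [Measure.map_apply (s.measurable_θ m) (measurableSet_singleton _)]
  exact s.measure_θ_ne_zero m _

theorem measure_inter_independent (m : Fin M) (A : Set (Fin N → ℕ)) (B : Set ℕ)
    (F : Set (Fin (K m))) (G : Set ℕ) :
    s.μ {ω | (fun n => s.S n ω) ∈ A ∧ s.Zc ω ∈ B ∧ s.θ m ω ∈ F ∧ s.Z m ω ∈ G} =
      s.μ {ω | (fun n => s.S n ω) ∈ A ∧ s.Zc ω ∈ B} * s.μ (s.θ m ⁻¹' F) *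
        s.μ (s.Z m ⁻¹' G) := by
  have := s.isProbabilityMeasure_map_θ
  have := s.isProbabilityMeasure_map_Z
  have := s.isProbabilityMeasure_map_S
  have := s.isProbabilityMeasure_map_Zc
  have h := s.independent
  change s.μ.map s.source = _ at h
  have key : ∀ (F : Set (Fin (K m))) (G : Set ℕ),
      s.μ {ω | (fun n => s.S n ω) ∈ A ∧ s.Zc ω ∈ B ∧ s.θ m ω ∈ F ∧ s.Z m ω ∈ G} =
      s.μ.map (fun ω n => s.S n ω) A * (s.μ.map s.Zc B * (s.μ.map (s.θ m) F *
        s.μ.map (s.Z m) G)) := by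
    intro F G
    have h1 : {ω | (fun n => s.S n ω) ∈ A ∧ s.Zc ω ∈ B ∧ s.θ m ω ∈ F ∧ s.Z m ω ∈ G} =
        s.source ⁻¹' (A ×ˢ (B ×ˢ ((Function.eval m ⁻¹' F) ×ˢ (Function.eval m ⁻¹' G)))) := by
      ext ω
      simp [source]
    rw [h1, ← Measure.map_apply s.measurable_source .of_discrete, h, Measure.prod_prod,
      Measure.prod_prod, Measure.prod_prod]
    rw [(measurePreserving_eval (fun m => s.μ.map (s.θ m)) m).measure_preimage
        MeasurableSet.of_discrete.nullMeasurableSet,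
      (measurePreserving_eval (fun m => s.μ.map (s.Z m)) m).measure_preimage
        MeasurableSet.of_discrete.nullMeasurableSet]
  have h2 := key Set.univ Set.univ
  simp only [Set.mem_univ, and_true, measure_univ, mul_one] at h2
  rw [key F G, h2, Measure.map_apply (s.measurable_θ m) .of_discrete,
    Measure.map_apply (s.measurable_Z m) .of_discrete]
  ring

end Scheme

namespace Scheme

variable {q L M N X : ℕ} {K T : Fin M → ℕ} (s : Scheme q L N X K T)

theorem measurable_query (m : Fin M) : Measurable fun ω n => s.Q m n ω :=
  measurable_pi_lambda _ (s.measurable_Q m)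

/-- The law of the queries of user `m` to `T m` servers does not depend on its index. -/
theorem map_query_eq (m : Fin M) (Qf : Fin (K m) × ℕ → Fin N → ℕ)
    (hQ : ∀ᵐ ω ∂s.μ, (fun n => s.Q m n ω) = Qf (s.θ m ω, s.Z m ω))
    (τ : Finset (Fin N)) (hτ : τ.card = T m) (k k' : Fin (K m)) :
    (s.μ.map (s.Z m)).map (fun y (n : τ) => Qf (k, y) n) =
      (s.μ.map (s.Z m)).map (fun y (n : τ) => Qf (k', y) n) := by
  have hC : Measurable fun ω => ((fun n : τ => s.S n ω), s.Zc ω) :=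
    (measurable_pi_lambda (fun ω (n : τ) => s.S n ω) fun n => s.measurable_S n).prodMk
      s.measurable_Zc
  -- The privacy condition is conditional on storage and common randomness, but these are
  -- independent of the index and randomness of user `m`. One conditioning value of positive
  -- probability therefore suffices.
  obtain ⟨⟨c, z⟩, hcz⟩ := exists_measure_fiber_ne_zero (μ := s.μ)
    (fun ω => ((fun n : τ => s.S n ω), s.Zc ω))
  set E := (fun ω => ((fun n : τ => s.S n ω), s.Zc ω)) ⁻¹' {(c, z)} with hE
  have hEm : MeasurableSet E := hC .of_discrete
  have hP' := cond_isProbabilityMeasure hcz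
  have hpriv := s.privacy m τ hτ.le
  rw [condMutualInfo, ENNReal.tsum_eq_zero] at hpriv
  have hmi := (mul_eq_zero.1 (hpriv (c, z))).resolve_left hcz
  have hQm : Measurable fun ω (i : Fin M) (n : τ) => s.Q i n ω :=
    measurable_pi_lambda _ fun i => measurable_pi_lambda _ fun n => s.measurable_Q i n
  have hEset : E = {ω | (fun n => s.S n ω) ∈ {x : Fin N → ℕ | ∀ n : τ, x n = c n} ∧
      s.Zc ω ∈ ({z} : Set ℕ)} := by
    ext ω
    simp [hE, Prod.ext_iff, funext_iff]
  -- The right side does not mention `k`. Both sides, multiplied by the probability of index `k`,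
  -- equal the conditional probability of index `k` jointly with query `v`.
  have main : ∀ (k : Fin (K m)) (v : τ → ℕ),
      (s.μ.map (s.Z m)).map (fun y (n : τ) => Qf (k, y) n) {v} =
        s.μ[|E] ((fun ω (i : Fin M) (n : τ) => s.Q i n ω) ⁻¹' {u | u m = v}) := by
    intro k v
    set G : Set ℕ := (fun y (n : τ) => Qf (k, y) n) ⁻¹' {v} with hG
    have h1 := measure_inter_eq_mul_of_mutualInfo_eq_zero (s.measurable_θ m) hQm hmi
      (s := {k}) (t := {u | u m = v}) .of_discrete .of_discrete
    have h2 : ∀ G : Set ℕ, s.μ[|E] (s.θ m ⁻¹' {k} ∩ s.Z m ⁻¹' G) =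
        s.μ (s.θ m ⁻¹' {k}) * s.μ (s.Z m ⁻¹' G) := by
      intro G
      rw [cond_apply hEm]
      have h3 : E ∩ (s.θ m ⁻¹' {k} ∩ s.Z m ⁻¹' G) =
          {ω | (fun n => s.S n ω) ∈ {x : Fin N → ℕ | ∀ n : τ, x n = c n} ∧
            s.Zc ω ∈ ({z} : Set ℕ) ∧ s.θ m ω ∈ ({k} : Set (Fin (K m))) ∧ s.Z m ω ∈ G} := by
        rw [hEset]
        ext ω
        simp only [Set.mem_inter_iff, Set.mem_ofPred_eq, Set.mem_preimage]
        tauto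
      rw [h3, measure_inter_independent, ← hEset, mul_assoc, ← mul_assoc,
        ENNReal.inv_mul_cancel hcz (measure_ne_top _ _), one_mul]
    have h4 : s.μ[|E] (s.θ m ⁻¹' {k}) = s.μ (s.θ m ⁻¹' {k}) := by
      simpa using h2 Set.univ
    have h5 : s.μ[|E] (s.θ m ⁻¹' {k} ∩
        (fun ω (i : Fin M) (n : τ) => s.Q i n ω) ⁻¹' {u | u m = v}) =
        s.μ[|E] (s.θ m ⁻¹' {k} ∩ s.Z m ⁻¹' G) := by
      refine measure_congr ?_
      filter_upwards [cond_absolutelyContinuous.ae_le hQ] with ω hω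
      refine propext (and_congr_right fun hk => ?_)
      have hk' : s.θ m ω = k := hk
      rw [hk'] at hω
      change (fun n : τ => s.Q m n ω) = v ↔ (fun n : τ => Qf (k, s.Z m ω) n) = v
      have : (fun n : τ => s.Q m n ω) = fun n : τ => Qf (k, s.Z m ω) n := by
        funext n
        exact congrFun hω n
      rw [this]
    rw [h5, h2, h4] at h1
    rw [Measure.map_apply .of_discrete .of_discrete, Measure.map_apply (s.measurable_Z m)
      .of_discrete]
    exact (ENNReal.mul_right_inj (s.measure_θ_ne_zero m k) (measure_ne_top _ _)).1 h1
  refine Measure.ext_of_singleton fun v => ?_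
  rw [main k v, main k' v]

/-- The storage of `X` servers is independent of the database, hence of the messages along any
injective family of index tuples. -/
theorem storage_security (hq : 1 ≤ q) (w : (Fin N → ℕ) → ((m : Fin M) → Fin (K m)) → Fin L → Fin q)
    (hw : ∀ᵐ ω ∂s.μ, s.W ω = w fun n => s.S n ω) {κ : Type*} [Fintype κ]
    (j : κ → (m : Fin M) → Fin (K m)) (hj : Function.Injective j) (𝒳 : Finset (Fin N))
    (h𝒳 : 𝒳.card ≤ X) (x : 𝒳 → ℕ) (b : κ → Fin L → Fin q) :
    (s.μ.map fun ω n => s.S n ω).real {c | (∀ n : 𝒳, c n = x n) ∧ ∀ k, w c (j k) = b k} =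
      (s.μ.map fun ω n => s.S n ω).real {c | ∀ n : 𝒳, c n = x n} *
        ((Fintype.card (Fin L → Fin q) : ℝ) ^ Fintype.card κ)⁻¹ := by
  classical
  have : NeZero q := ⟨by omega⟩
  have hS : Measurable fun ω n => s.S n ω := measurable_pi_lambda _ s.measurable_S
  have hS' : Measurable fun ω (n : 𝒳) => s.S n ω :=
    measurable_pi_lambda _ fun n => s.measurable_S n
  have h1 := measure_inter_eq_mul_of_mutualInfo_eq_zero s.measurable_W hS' (s.security 𝒳 h𝒳)
    (s := {D | ∀ k, D (j k) = b k}) (t := {x}) .of_discrete .of_discrete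
  rw [← Measure.map_apply s.measurable_W .of_discrete, s.uniform_W, uniformOn_univ_comp j hj]
    at h1
  have e1 : (s.μ.map fun ω n => s.S n ω) {c | (∀ n : 𝒳, c n = x n) ∧ ∀ k, w c (j k) = b k} =
      s.μ (s.W ⁻¹' {D | ∀ k, D (j k) = b k} ∩ (fun ω (n : 𝒳) => s.S n ω) ⁻¹' {x}) := by
    rw [Measure.map_apply hS .of_discrete]
    refine measure_congr ?_
    filter_upwards [hw] with ω hω
    refine propext ?_
    change ((∀ n : 𝒳, s.S n ω = x n) ∧ ∀ k, w (fun n => s.S n ω) (j k) = b k) ↔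
      (∀ k, s.W ω (j k) = b k) ∧ (fun n : 𝒳 => s.S n ω) = x
    rw [hω, funext_iff]
    tauto
  have e2 : (s.μ.map fun ω n => s.S n ω) {c | ∀ n : 𝒳, c n = x n} =
      s.μ ((fun ω (n : 𝒳) => s.S n ω) ⁻¹' {x}) := by
    rw [Measure.map_apply hS .of_discrete]
    congr 1
    ext ω
    simp [funext_iff]
  rw [Measure.real, Measure.real, e1, e2, h1, ENNReal.toReal_mul, mul_comm]
  simp

theorem length_le_of_downloadCost_le {d : ℕ} (hd : s.downloadCost ≤ d) (a : Fin N → QString q)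
    (ha : s.μ {ω | ∀ n, s.A n ω = a n} ≠ 0) : ∑ n, (a n).length ≤ d := by
  have h : ((∑ n, (a n).length : ℕ) : ℕ∞) ≤ s.downloadCost :=
    le_iSup₂_of_le (f := fun (a : Fin N → QString q) (_ : s.μ {ω | ∀ n, s.A n ω = a n} ≠ 0) =>
      ((∑ n, (a n).length : ℕ) : ℕ∞)) a ha le_rfl
  exact_mod_cast h.trans hd

/-- The download cost is bounded below by the cost of `X`-secure `T m`-private retrieval. -/
theorem length_mul_geom_sum_mul_le_downloadCost (hq : 2 ≤ q) (m : Fin M) (hK : ∀ m, 1 ≤ K m)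
    (hN : X + T m < N) {d : ℕ} (hd : s.downloadCost ≤ d) :
    N * (L * ∑ j ∈ Finset.range (K m), ((T m : ℝ) / ((N : ℝ) - X)) ^ j) ≤
      ((N : ℝ) - X) * d := by
  classical
  have : NeZero q := ⟨by omega⟩
  have hS : Measurable fun ω n => s.S n ω := measurable_pi_lambda _ s.measurable_S
  have hθZ : ∀ m, Measurable fun ω => (s.θ m ω, s.Z m ω) := fun m =>
    (s.measurable_θ m).prodMk (s.measurable_Z m)
  obtain ⟨w, hw⟩ := exists_ae_eq_of_condEntropy_eq_zero s.measurable_W hS s.stored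
  have hQf : ∀ m, ∃ g : Fin (K m) × ℕ → Fin N → ℕ,
      ∀ᵐ ω ∂s.μ, (fun n => s.Q m n ω) = g (s.θ m ω, s.Z m ω) := fun m =>
    exists_ae_eq_of_condEntropy_eq_zero (s.measurable_query m) (hθZ m) (s.query m)
  choose Qf hQf using hQf
  have hf : ∀ n, ∃ g : ℕ × (Fin M → ℕ) × ℕ → QString q,
      ∀ᵐ ω ∂s.μ, s.A n ω = g (s.S n ω, (fun m => s.Q m n ω), s.Zc ω) := fun n =>
    exists_ae_eq_of_condEntropy_eq_zero (s.measurable_A n) ((s.measurable_S n).prodMk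
      ((measurable_pi_lambda _ fun m => s.measurable_Q m n).prodMk s.measurable_Zc)) (s.answer n)
  choose f hf using hf
  have hWθ : Measurable fun ω => s.W ω (fun i => s.θ i ω) := by
    have : Measurable fun p : (((m : Fin M) → Fin (K m)) → Fin L → Fin q) ×
        ((m : Fin M) → Fin (K m)) => p.1 p.2 := .of_discrete
    exact this.comp (s.measurable_W.prodMk (measurable_pi_lambda _ s.measurable_θ))
  obtain ⟨dec, hdec⟩ := exists_ae_eq_of_condEntropy_eq_zero hWθ
    ((measurable_pi_lambda _ s.measurable_A).prodMk (hθZ m)) (s.correct m)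
  obtain ⟨z₀, hz₀⟩ := exists_measure_fiber_ne_zero (μ := s.μ) s.Zc
  rw [← Measure.map_apply s.measurable_Zc (measurableSet_singleton _)] at hz₀
  have hy₀ : ∀ i, ∃ y, s.μ.map (s.Z i) {y} ≠ 0 := by
    intro i
    obtain ⟨y, hy⟩ := exists_measure_fiber_ne_zero (μ := s.μ) (s.Z i)
    exact ⟨y, by rwa [Measure.map_apply (s.measurable_Z i) (measurableSet_singleton _)]⟩
  choose y₀ hy₀ using hy₀
  -- The other users are frozen at index `0` and randomness `y₀`, and the common randomness at `z₀`.
  -- User `m` then retrieves among the tuples that vary only in coordinate `m`.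
  let t₀ : (i : Fin M) → Fin (K i) := fun i => ⟨0, hK i⟩
  let Qm : Fin (K m) → ℕ → Fin N → ℕ := fun k y n => Qf m (k, y) n
  let a : Fin N → ℕ → ℕ → List (Fin q) := fun n v x =>
    f n (x, Function.update (fun i => Qf i (t₀ i, y₀ i) n) m v, z₀)
  have good : ∀ᵐ ω ∂s.μ, s.W ω = w (fun n => s.S n ω) ∧
      (∀ i n, s.Q i n ω = Qf i (s.θ i ω, s.Z i ω) n) ∧
      (∀ n, s.A n ω = f n (s.S n ω, (fun i => s.Q i n ω), s.Zc ω)) ∧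
      s.W ω (fun i => s.θ i ω) = dec ((fun n => s.A n ω), s.θ m ω, s.Z m ω) := by
    filter_upwards [hw, ae_all_iff.2 hQf, ae_all_iff.2 hf, hdec] with ω h1 h2 h3 h4
    exact ⟨h1, fun i n => congrFun (h2 i) n, h3, h4⟩
  -- Each index, randomness and storage atom of the reduced scheme occurs in the original one with
  -- positive probability. Decoding, length bound and prefix-freeness are transferred through this.
  have atom : ∀ (k : Fin (K m)) (y : ℕ), s.μ.map (s.Z m) {y} ≠ 0 → ∀ c : Fin N → ℕ,
      s.μ.map (fun ω n => s.S n ω) {c} ≠ 0 →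
      s.μ {ω | (∀ n, s.A n ω = a n (Qm k y n) (c n)) ∧
        (∀ n i, s.Q i n ω = Function.update (fun i => Qf i (t₀ i, y₀ i) n) m (Qm k y n) i) ∧
        w c (Function.update t₀ m k) = dec ((fun n => s.A n ω), k, y)} ≠ 0 := by
    intro k y hy c hc hzero
    refine s.measure_source_ne_zero c z₀ (Function.update t₀ m k) (Function.update y₀ m y)
      hc hz₀ (fun i => ?_) (measure_mono_null_ae ?_ hzero)
    · by_cases hi : i = m
      · subst hi; simpa using hy
      · simpa [hi] using hy₀ i
    · filter_upwards [good] with ω ⟨h1, h2, h3, h4⟩ hω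
      have hω' : s.source ω = (c, z₀, Function.update t₀ m k, Function.update y₀ m y) := hω
      simp only [source, Prod.mk.injEq] at hω'
      obtain ⟨hc', hz', ht', hy'⟩ := hω'
      have hQ : ∀ n i, s.Q i n ω =
          Function.update (fun i => Qf i (t₀ i, y₀ i) n) m (Qm k y n) i := by
        intro n i
        rw [h2, congrFun ht' i, congrFun hy' i]
        by_cases hi : i = m
        · subst hi; simp [Qm]
        · simp [hi]
      refine ⟨fun n => ?_, hQ, ?_⟩
      · rw [h3, hz', congrFun hc' n]
        simp only [a]
        congr 3
        funext i
        exact hQ n i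
      · rw [h1, ht', hc', congrFun ht' m, congrFun hy' m] at h4
        simpa using h4
  have hPS := s.isProbabilityMeasure_map_S
  have hPZ := s.isProbabilityMeasure_map_Z m
  have hinj : Function.Injective fun k : Fin (K m) => Function.update t₀ m k :=
    Function.update_injective t₀ m
  have key := log_card_mul_geom_sum_mul_le_download (d := d) (s.μ.map fun ω n => s.S n ω)
    (s.μ.map (s.Z m)) (fun k c => w c (Function.update t₀ m k)) Qm a (by omega) X (T m) hN
    (fun 𝒳 h𝒳 x b => by
      have := s.storage_security (by omega) w hw _ hinj 𝒳 h𝒳.le x b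
      rwa [Fintype.card_fin] at this)
    (fun τ hτ k k' => s.map_query_eq m (Qf m) (hQf m) τ hτ k k')
    (fun k y hy c c' hc hc' h => by
      obtain ⟨ω, hω⟩ := nonempty_of_measure_ne_zero (atom k y hy c hc)
      obtain ⟨ω', hω'⟩ := nonempty_of_measure_ne_zero (atom k y hy c' hc')
      have e : (fun n => s.A n ω) = fun n => s.A n ω' := by
        funext n
        rw [hω.1 n, hω'.1 n]
        exact h n
      rw [hω.2.2, hω'.2.2, e])
    (fun k y hy c hc => s.length_le_of_downloadCost_le hd _ fun h0 =>
      atom k y hy c hc (measure_mono_null (fun ω hω => hω.1) h0))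
    (fun k y hy c c' hc hc' n hp => by
      refine s.prefixFree n (Function.update (fun i => Qf i (t₀ i, y₀ i) n) m (Qm k y n)) _ _
        (fun h0 => atom k y hy c hc (measure_mono_null (fun ω hω => ?_) h0))
        (fun h0 => atom k y hy c' hc' (measure_mono_null (fun ω hω => ?_) h0)) hp
      · exact ⟨hω.2.1 n, hω.1 n⟩
      · exact ⟨hω.2.1 n, hω.1 n⟩)
    (hK m)
  have hlog : 0 < Real.log q := Real.log_pos (by exact_mod_cast hq)
  rw [Fintype.card_fun, Fintype.card_fin, Fintype.card_fin, Nat.cast_pow, Real.log_pow] at key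
  refine le_of_mul_le_mul_left ?_ hlog
  calc _ = _ := by ring
    _ ≤ _ := key
    _ = _ := by ring

/-- Upper bound on the rate of a scheme. -/
theorem rate_le (hq : 2 ≤ q) (hL : 1 ≤ L) (m : Fin M) (hK : ∀ m, 1 ≤ K m) (hN : X + T m < N) :
    s.rate ≤ ENNReal.ofReal ((1 - ((T m : ℝ) + X) / N) /
      (1 - ((T m : ℝ) / ((N : ℝ) - X)) ^ K m)) := by
  rw [rate]
  rcases eq_or_ne s.downloadCost ⊤ with hD | hD
  · simp [hD]
  obtain ⟨d, hd⟩ := ENat.ne_top_iff_exists.1 hD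
  have h := s.length_mul_geom_sum_mul_le_downloadCost hq m hK hN hd.symm.le
  set ρ : ℝ := (T m : ℝ) / ((N : ℝ) - X) with hρ
  set G := ∑ j ∈ Finset.range (K m), ρ ^ j with hG
  have hNT : (X : ℝ) + T m < N := by exact_mod_cast hN
  have hT : (0 : ℝ) ≤ T m := Nat.cast_nonneg _
  have hX : (0 : ℝ) ≤ X := Nat.cast_nonneg _
  have hNX : (0 : ℝ) < (N : ℝ) - X := by linarith
  have hN0 : (0 : ℝ) < N := by linarith
  have hρ0 : 0 ≤ ρ := div_nonneg hT hNX.le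
  have hρ1 : ρ < 1 := by rw [hρ, div_lt_one hNX]; linarith
  have hG1 : 0 < G := by
    obtain ⟨j, hj⟩ : ∃ j, K m = j + 1 := ⟨K m - 1, by have := hK m; omega⟩
    rw [hG, hj, Finset.sum_range_succ']
    have : 0 ≤ ∑ k ∈ Finset.range j, ρ ^ (k + 1) := Finset.sum_nonneg fun _ _ => by positivity
    simp only [pow_zero]
    linarith
  have hgeom : (1 - ρ) * G = 1 - ρ ^ K m := mul_neg_geom_sum ρ (K m)
  have hL0 : (0 : ℝ) < L := by exact_mod_cast hL
  have hd0 : (0 : ℝ) < d := by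
    by_contra hc
    have h1 : ((N : ℝ) - X) * d ≤ 0 := mul_nonpos_of_nonneg_of_nonpos hNX.le (not_lt.1 hc)
    have h2 : 0 < (N : ℝ) * (L * G) := by positivity
    linarith
  have hval : (1 - ((T m : ℝ) + X) / N) / (1 - ρ ^ K m) = ((N : ℝ) - X) / (N * G) := by
    rw [← hgeom, hρ]
    have : (N : ℝ) - X - T m ≠ 0 := by linarith
    have : 1 - (T m : ℝ) / ((N : ℝ) - X) = ((N : ℝ) - X - T m) / ((N : ℝ) - X) := by
      field_simp
    rw [this]
    field_simp
    ring
  rw [hval, ← hd]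
  have e : ((L : ℝ≥0∞)) / (((d : ℕ∞) : ℝ≥0∞)) = ENNReal.ofReal ((L : ℝ) / d) := by
    rw [ENNReal.ofReal_div_of_pos hd0, ENNReal.ofReal_natCast, ENNReal.ofReal_natCast]
    simp
  rw [e]
  refine ENNReal.ofReal_le_ofReal ?_
  rw [div_le_div_iff₀ hd0 (by positivity)]
  linarith

end Scheme

theorem capacity_le {M : ℕ} (N X : ℕ) (K T : Fin M → ℕ) (hK : ∀ m, 1 ≤ K m)
    (hN : ∀ m, X + T m < N) : capacity N X K T ≤
      ⨅ m : Fin M, ENNReal.ofReal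
        ((1 - ((T m : ℝ) + (X : ℝ)) / (N : ℝ)) /
          (1 - ((T m : ℝ) / ((N : ℝ) - (X : ℝ))) ^ K m)) :=
  le_iInf fun m => iSup₂_le fun _ hq => iSup₂_le fun _ hL =>
    iSup_le fun s => s.rate_le hq.two_le hL m hK (hN m)

/-! ### Criteria for vanishing information on finite uniform spaces -/

section Criteria

set_option linter.unusedSectionVars false

variable {Ω α β γ : Type*} [MeasurableSpace Ω] [DiscreteMeasurableSpace Ω] {μ : Measure Ω}
  [IsProbabilityMeasure μ]

theorem condEntropy_eq_zero_of_determines (A : Ω → α) (B : Ω → β)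
    (h : ∀ ω ω', B ω = B ω' → A ω = A ω') : condEntropy μ A B = 0 := by
  rw [condEntropy, ENNReal.tsum_eq_zero]
  intro b
  by_cases hb : μ (B ⁻¹' {b}) = 0
  · rw [hb, zero_mul]
  have := cond_isProbabilityMeasure hb
  obtain ⟨ω₀, hω₀⟩ := nonempty_of_measure_ne_zero hb
  rw [entropy, ENNReal.tsum_eq_zero.2, mul_zero]
  intro a
  have h0 : ∀ ω, ω ∈ B ⁻¹' {b} → A ω = A ω₀ := fun ω hω => h _ _ (hω.trans hω₀.symm)
  rw [Measure.real, cond_apply .of_discrete]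
  by_cases ha : a = A ω₀
  · rw [show B ⁻¹' {b} ∩ A ⁻¹' {a} = B ⁻¹' {b} from
      Set.inter_eq_left.2 fun ω hω => (h0 ω hω).trans ha.symm,
      ENNReal.inv_mul_cancel hb (measure_ne_top _ _)]
    simp
  · have : B ⁻¹' {b} ∩ A ⁻¹' {a} = ∅ := by
      ext ω
      simp only [Set.mem_inter_iff, Set.mem_empty_iff_false, iff_false, not_and]
      exact fun hω hA => ha (hA.symm.trans (h0 ω hω))
    rw [this]
    simp

theorem card_mul_measure_fiber_eq_one [Fintype α] (f : Ω → α)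
    (h : ∀ a a', μ (f ⁻¹' {a}) ≤ μ (f ⁻¹' {a'})) (a : α) :
    Fintype.card α * μ (f ⁻¹' {a}) = 1 := by
  have h1 : μ (⋃ a, f ⁻¹' {a}) = ∑' a, μ (f ⁻¹' {a}) :=
    measure_iUnion (fun a a' haa => Set.disjoint_left.2 fun ω hω hω' =>
      haa ((show f ω = a from hω).symm.trans hω')) fun _ => .of_discrete
  have hU : ⋃ a, f ⁻¹' {a} = Set.univ := by ext; simp
  rw [hU, measure_univ, tsum_fintype] at h1
  rw [h1, Finset.sum_congr rfl fun a' _ => le_antisymm (h a' a) (h a a')]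
  simp

theorem map_eq_uniformOn [Fintype α] [MeasurableSpace α] [DiscreteMeasurableSpace α] (f : Ω → α)
    (h : ∀ a a', μ (f ⁻¹' {a}) ≤ μ (f ⁻¹' {a'})) : μ.map f = uniformOn Set.univ := by
  refine Measure.ext_of_singleton fun a => ?_
  have h1 := card_mul_measure_fiber_eq_one f h a
  rw [Measure.map_apply .of_discrete .of_discrete, uniformOn_univ, Measure.count_singleton,
    ENNReal.eq_div_iff (by intro h0; simp [h0] at h1) (by simp), h1]

/-- If joint probabilities do not depend on the value of `f`, then `f` is uniform and independent of
`g`. Inequalities suffice because `a` and `a'` may be exchanged. -/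
theorem mutualInfo_eq_zero_of_symmetric [Fintype α] [MeasurableSpace α]
    [DiscreteMeasurableSpace α] [Countable β] [MeasurableSpace β] [DiscreteMeasurableSpace β]
    (f : Ω → α) (g : Ω → β)
    (h : ∀ a a' b, μ (f ⁻¹' {a} ∩ g ⁻¹' {b}) ≤ μ (f ⁻¹' {a'} ∩ g ⁻¹' {b})) :
    mutualInfo μ f g = 0 := by
  have hf : Measurable f := .of_discrete
  have hg : Measurable g := .of_discrete
  have := Measure.isProbabilityMeasure_map (μ := μ) hf.aemeasurable
  have := Measure.isProbabilityMeasure_map (μ := μ) hg.aemeasurable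
  have hfib : ∀ a a', μ (f ⁻¹' {a}) ≤ μ (f ⁻¹' {a'}) := by
    intro a a'
    have e : (μ.restrict (f ⁻¹' {a})).map g = (μ.restrict (f ⁻¹' {a'})).map g := by
      refine Measure.ext_of_singleton fun b => ?_
      rw [Measure.map_apply hg .of_discrete, Measure.map_apply hg .of_discrete,
        Measure.restrict_apply .of_discrete, Measure.restrict_apply .of_discrete,
        Set.inter_comm, Set.inter_comm (g ⁻¹' {b})]
      exact le_antisymm (h a a' b) (h a' a b)
    have e1 := congrArg (fun ν => ν Set.univ) e
    simp only [Measure.map_apply hg .of_discrete, Set.preimage_univ,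
      Measure.restrict_apply .of_discrete, Set.univ_inter] at e1
    exact e1.le
  have e : μ.map (fun ω => (f ω, g ω)) = (μ.map f).prod (μ.map g) := by
    refine Measure.ext_of_singleton fun ⟨a, b⟩ => ?_
    rw [← Set.singleton_prod_singleton, Measure.prod_prod,
      Measure.map_apply (hf.prodMk hg) .of_discrete, Measure.map_apply hf .of_discrete,
      Measure.map_apply hg .of_discrete, Set.mk_preimage_prod]
    have h1 := card_mul_measure_fiber_eq_one f hfib a
    have h2 : μ (g ⁻¹' {b}) = Fintype.card α * μ (f ⁻¹' {a} ∩ g ⁻¹' {b}) := by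
      have hu : g ⁻¹' {b} = ⋃ a, f ⁻¹' {a} ∩ g ⁻¹' {b} := by ext; simp
      conv_lhs => rw [hu]
      rw [measure_iUnion (fun a a' haa => Set.disjoint_left.2 fun ω hω hω' =>
        haa ((show f ω = a from hω.1).symm.trans hω'.1)) fun _ => .of_discrete, tsum_fintype,
        Finset.sum_congr rfl fun a' _ => le_antisymm (h a' a b) (h a a' b)]
      simp
    rw [h2, ← mul_assoc, mul_comm (μ (f ⁻¹' {a})), h1, one_mul]
  rw [mutualInfo, e, InformationTheory.klDiv_self]

theorem condMutualInfo_eq_zero_of_symmetric [Fintype α] [MeasurableSpace α]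
    [DiscreteMeasurableSpace α] [Countable β] [MeasurableSpace β] [DiscreteMeasurableSpace β]
    (f : Ω → α) (g : Ω → β) (k : Ω → γ)
    (h : ∀ a a' b c, μ (k ⁻¹' {c} ∩ (f ⁻¹' {a} ∩ g ⁻¹' {b})) ≤
      μ (k ⁻¹' {c} ∩ (f ⁻¹' {a'} ∩ g ⁻¹' {b}))) :
    condMutualInfo μ f g k = 0 := by
  rw [condMutualInfo, ENNReal.tsum_eq_zero]
  intro c
  by_cases hc : μ (k ⁻¹' {c}) = 0
  · rw [hc, zero_mul]
  have := cond_isProbabilityMeasure hc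
  rw [mutualInfo_eq_zero_of_symmetric, mul_zero]
  intro a a' b
  rw [cond_apply .of_discrete, cond_apply .of_discrete]
  exact mul_le_mul_right (h a a' b c) _

/-- Under equal atoms, measure is counting. Each secrecy property of the construction thus reduces
to an injective change of outcomes that alters the secret and preserves the view. -/
theorem measure_le_of_injOn [Finite Ω] (hμ : ∀ ω ω', μ {ω} = μ {ω'}) (e : Ω → Ω) {s t : Set Ω}
    (hst : Set.MapsTo e s t) (hinj : Set.InjOn e s) : μ s ≤ μ t := by
  classical
  have := Fintype.ofFinite Ω
  have h : ∀ s : Set Ω, μ s = ∑ ω ∈ s.toFinset, μ {ω} := by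
    intro s
    rw [sum_measure_singleton, Set.coe_toFinset]
  rw [h, h, Finset.sum_congr rfl fun ω _ => hμ ω (e ω),
    ← Finset.sum_image (f := fun ω => μ {ω}) (by simpa using hinj)]
  refine Finset.sum_le_sum_of_subset ?_
  intro x hx
  obtain ⟨ω, hω, rfl⟩ := Finset.mem_image.1 hx
  exact Set.mem_toFinset.2 (hst (Set.mem_toFinset.1 hω))

end Criteria

/-! ### Polynomial secret sharing and Cauchy-Vandermonde systems -/

section Algebra

open Polynomial

variable {F : Type*} [Field F]

theorem eval_eq_sum_fin {p : F[X]} {n : ℕ} (hp : p.degree < n) (x : F) :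
    p.eval x = ∑ i : Fin n, p.coeff i * x ^ (i : ℕ) := by
  by_cases h : p = 0
  · simp [h]
  · rw [eval_eq_sum_range' ((natDegree_lt_iff_degree_lt h).2 hp),
      Finset.sum_range fun i => p.coeff i * x ^ i]

/-- The polynomial with value `a` at `f` whose other coefficients, in powers of `f - X`, are
given by `r`. -/
noncomputable def share {t : ℕ} (a : F) (r : Fin t → F) (f : F) : F[X] :=
  C a + ∑ x : Fin t, (C f - X) ^ ((x : ℕ) + 1) * C (r x)

@[simp]
theorem eval_share {t : ℕ} (a : F) (r : Fin t → F) (f y : F) :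
    (share a r f).eval y = a + ∑ x : Fin t, (f - y) ^ ((x : ℕ) + 1) * r x := by
  simp [share, eval_finsetSum]

theorem eval_share_self {t : ℕ} (a : F) (r : Fin t → F) (f : F) : (share a r f).eval f = a := by
  simp

theorem natDegree_C_sub_X_le (f : F) : (C f - X : F[X]).natDegree ≤ 1 :=
  (natDegree_sub_le _ _).trans (by simp)

theorem natDegree_share_le {t : ℕ} (a : F) (r : Fin t → F) (f : F) :
    (share a r f).natDegree ≤ t := by
  refine (natDegree_add_le _ _).trans (max_le (by simp) ?_)
  refine natDegree_sum_le_of_forall_le _ _ fun x _ => ?_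
  refine natDegree_mul_le.trans ?_
  rw [natDegree_C, add_zero]
  have h1 := natDegree_pow_le_of_le ((x : ℕ) + 1) (natDegree_C_sub_X_le f)
  have := x.2
  omega

/-- Any `t` evaluations of `share` away from `f` are compatible with every secret. -/
theorem exists_share_shift {ι : Type*} (α : ι → F) (hα : Function.Injective α) (f : F)
    (hf : ∀ n, f ≠ α n) {t : ℕ} (τ : Finset ι) (hτ : τ.card ≤ t) (a a' : F) :
    ∃ δ : Fin t → F, ∀ n ∈ τ, ∀ r : Fin t → F,
      (share a' (r + δ) f).eval (α n) = (share a r f).eval (α n) := by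
  classical
  have hinj : Set.InjOn (fun n => f - α n) (τ : Set ι) := fun n _ n' _ h =>
    hα (sub_right_injective h)
  -- The shift must satisfy `u * p(u) = a - a'` at each node `u = f - α n`. Nodes are nonzero and
  -- number at most `t`, so interpolation provides a `p` of degree below `t`.
  set p := Lagrange.interpolate τ (fun n => f - α n) (fun n => (a - a') / (f - α n)) with hp
  have hdeg : p.degree < t :=
    (Lagrange.degree_interpolate_lt _ hinj).trans_le (by exact_mod_cast hτ)
  refine ⟨fun x => p.coeff x, fun n hn r => ?_⟩
  have h1 := Lagrange.eval_interpolate_at_node (fun n => (a - a') / (f - α n)) hinj hn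
  rw [← hp, eval_eq_sum_fin hdeg, eq_div_iff (sub_ne_zero.2 (hf n)), Finset.sum_mul] at h1
  have h2 : ∑ x : Fin t, (f - α n) ^ ((x : ℕ) + 1) * p.coeff x = a - a' := by
    rw [← h1]
    exact Finset.sum_congr rfl fun x _ => by ring
  simp only [eval_share, Pi.add_apply, mul_add, Finset.sum_add_distrib, h2]
  ring

/-- Division of a polynomial value by `f - y`. -/
theorem exists_inv_mul_eval_eq {G : F[X]} {E : ℕ} (hG : G.natDegree ≤ E) (f : F) :
    ∃ c : Fin E → F, ∀ y, f ≠ y →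
      -- With `G = G(f) + (X - f) * H`, dividing by `f - y` leaves `-H(y)`, and `H` has degree below
      -- `E`.
      (f - y)⁻¹ * G.eval y = (f - y)⁻¹ * G.eval f + ∑ j : Fin E, y ^ (j : ℕ) * c j := by
  set H := G /ₘ (X - C f) with hH
  have hdeg : H.degree < E := by
    by_cases h0 : H = 0
    · rw [h0, degree_zero]; exact WithBot.bot_lt_coe _
    · rw [← natDegree_lt_iff_degree_lt h0]
      have h1 := natDegree_divByMonic G (monic_X_sub_C f)
      rw [natDegree_X_sub_C, ← hH] at h1
      have h2 : (X - C f).degree ≤ G.degree := by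
        by_contra hlt
        exact h0 ((divByMonic_eq_zero_iff (monic_X_sub_C f)).2 (not_le.1 hlt))
      have h3 := natDegree_le_natDegree h2
      rw [natDegree_X_sub_C] at h3
      omega
  refine ⟨fun j => -H.coeff j, fun y hy => ?_⟩
  have h1 := congrArg (eval y) (modByMonic_add_div G (X - C f))
  rw [modByMonic_X_sub_C_eq_C_eval, ← hH] at h1
  simp only [eval_add, eval_mul, eval_sub, eval_X, eval_C] at h1
  have h2 : ∑ j : Fin E, y ^ (j : ℕ) * -H.coeff j = -H.eval y := by
    rw [eval_eq_sum_fin hdeg, ← Finset.sum_neg_distrib]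
    exact Finset.sum_congr rfl fun j _ => by ring
  have h3 := sub_ne_zero.2 hy
  rw [h2, ← h1]
  field_simp
  ring

/-- Cauchy-Vandermonde systems determine their Cauchy part. -/
theorem cauchy_part_eq_zero {N L E : ℕ} (hN : L + E ≤ N) (α : Fin N → F)
    (hα : Function.Injective α) (φ : Fin L → F) (hφ : Function.Injective φ)
    (hne : ∀ l n, φ l ≠ α n) (u : Fin L → F) (c : Fin E → F)
    (h : ∀ n, ∑ l, (φ l - α n)⁻¹ * u l + ∑ j : Fin E, α n ^ (j : ℕ) * c j = 0) : u = 0 := by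
  funext l₀
  -- Clearing denominators gives degree at most `L + E - 1 < N` with `N` roots `α n`, so `P = 0`. At
  -- `φ l₀` only the Cauchy term of `l₀` survives.
  set P : F[X] := ∑ l, C (u l) * ∏ l' ∈ Finset.univ.erase l, (C (φ l') - X) +
    ∑ j : Fin E, (∏ l, (C (φ l) - X)) * (C (c j) * X ^ (j : ℕ)) with hP
  have hL := l₀.2
  have hprod : ∀ s : Finset (Fin L), (∏ l ∈ s, (C (φ l) - X)).natDegree ≤ s.card := by
    intro s
    refine (natDegree_prod_le _ _).trans ?_
    refine (Finset.sum_le_card_nsmul _ _ 1 fun l _ => natDegree_C_sub_X_le _).trans (by simp)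
  have hdeg : P.natDegree ≤ N - 1 := by
    refine (natDegree_add_le _ _).trans (max_le ?_ ?_)
    · refine natDegree_sum_le_of_forall_le _ _ fun l _ => ?_
      refine (natDegree_C_mul_le _ _).trans ((hprod _).trans ?_)
      rw [Finset.card_erase_of_mem (Finset.mem_univ _), Finset.card_univ, Fintype.card_fin]
      omega
    · refine natDegree_sum_le_of_forall_le _ _ fun j _ => ?_
      refine natDegree_mul_le.trans ?_
      have h1 := hprod Finset.univ
      have h2 := natDegree_C_mul_X_pow_le (c j) (j : ℕ)
      rw [Finset.card_univ, Fintype.card_fin] at h1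
      have := j.2
      omega
  have heval : ∀ n, P.eval (α n) = 0 := by
    intro n
    have h1 : P.eval (α n) = (∏ l, (φ l - α n)) *
        (∑ l, (φ l - α n)⁻¹ * u l + ∑ j : Fin E, α n ^ (j : ℕ) * c j) := by
      simp only [hP, eval_add, eval_finsetSum, eval_mul, eval_prod, eval_sub, eval_C, eval_X,
        eval_pow]
      rw [mul_add, Finset.mul_sum, Finset.mul_sum]
      congr 1
      · refine Finset.sum_congr rfl fun l _ => ?_
        rw [← Finset.mul_prod_erase Finset.univ _ (Finset.mem_univ l)]
        have := sub_ne_zero.2 (hne l n)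
        field_simp
      · refine Finset.sum_congr rfl fun j _ => ?_
        ring
    rw [h1, h n, mul_zero]
  have hzero := eq_zero_of_natDegree_lt_card_of_eval_eq_zero P hα heval
    (by rw [Fintype.card_fin]; omega)
  have h1 := congrArg (eval (φ l₀)) hzero
  simp only [hP, eval_add, eval_finsetSum, eval_mul, eval_prod, eval_sub, eval_C, eval_X,
    eval_pow, eval_zero] at h1
  have h2 : ∏ l, (φ l - φ l₀) = 0 := Finset.prod_eq_zero (Finset.mem_univ l₀) (sub_self _)
  rw [Finset.sum_eq_single l₀] at h1
  · simp only [h2, zero_mul, Finset.sum_const_zero, add_zero] at h1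
    refine (mul_eq_zero.1 h1).resolve_right (Finset.prod_ne_zero_iff.2 fun l hl => ?_)
    exact sub_ne_zero.2 fun he => (Finset.mem_erase.1 hl).1 (hφ he)
  · intro l _ hl
    rw [Finset.prod_eq_zero (i := l₀) (Finset.mem_erase.2 ⟨hl.symm, Finset.mem_univ _⟩)
      (sub_self _), mul_zero]
  · simp

/-- Shares have degree at most `t`, so more than `t` evaluations fix the polynomial and its value at
`f`. -/
theorem share_secret_eq {N t : ℕ} (hN : t < N) (α : Fin N → F) (hα : Function.Injective α)
    (f a a' : F) (r r' : Fin t → F)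
    (h : ∀ n, (share a r f).eval (α n) = (share a' r' f).eval (α n)) : a = a' := by
  have hz := eq_zero_of_natDegree_lt_card_of_eval_eq_zero (share a r f - share a' r' f) hα
    (fun n => by rw [eval_sub, h n, sub_self])
    (by
      rw [Fintype.card_fin]
      exact ((natDegree_sub_le _ _).trans
        (max_le (natDegree_share_le _ _ _) (natDegree_share_le _ _ _))).trans_lt hN)
  rw [← eval_share_self a r f, ← eval_share_self a' r' f, sub_eq_zero.1 hz]

end Algebra

/-! ### Labels and uniform product laws -/

section Label

/-- An injective labelling of a countable type by natural numbers. -/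
noncomputable def label {α : Type*} [Countable α] : α → ℕ := (exists_injective_nat α).choose

theorem label_injective {α : Type*} [Countable α] : Function.Injective (label (α := α)) :=
  (exists_injective_nat α).choose_spec

instance isProbabilityMeasure_uniformOn_univ {α : Type*} [MeasurableSpace α]
    [MeasurableSingletonClass α] [Finite α] [Nonempty α] :
    IsProbabilityMeasure (uniformOn (Set.univ : Set α)) :=
  isProbabilityMeasure_uniformOn Set.finite_univ Set.univ_nonempty

theorem uniformOn_univ_singleton_eq {α : Type*} [MeasurableSpace α]
    [MeasurableSingletonClass α] [Finite α] (a a' : α) :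
    uniformOn (Set.univ : Set α) {a} = uniformOn (Set.univ : Set α) {a'} := by
  have := Fintype.ofFinite α
  rw [uniformOn_univ, uniformOn_univ, Measure.count_singleton, Measure.count_singleton]

end Label

section ProductLaw

set_option linter.unusedSectionVars false

variable {ι A B : Type*} {C D : ι → Type*} [Fintype ι] [Finite A] [Finite B] [∀ i, Finite (C i)]
  [∀ i, Finite (D i)] [MeasurableSpace A] [MeasurableSpace B] [∀ i, MeasurableSpace (C i)]
  [∀ i, MeasurableSpace (D i)] [DiscreteMeasurableSpace A] [DiscreteMeasurableSpace B]
  [∀ i, DiscreteMeasurableSpace (C i)] [∀ i, DiscreteMeasurableSpace (D i)]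

instance {α β : Type*} [Countable α] [Countable β] [MeasurableSpace α] [MeasurableSpace β]
    [DiscreteMeasurableSpace α] [DiscreteMeasurableSpace β] : DiscreteMeasurableSpace (α × β) :=
  inferInstance

/-- The uniform distribution on a finite product. -/
noncomputable def productLaw (A B : Type*) {ι : Type*} (C D : ι → Type*) [Fintype ι]
    [MeasurableSpace A] [MeasurableSpace B] [∀ i, MeasurableSpace (C i)]
    [∀ i, MeasurableSpace (D i)] : Measure (A × B × (∀ i, C i) × (∀ i, D i)) :=
  (uniformOn Set.univ).prod ((uniformOn Set.univ).prod
    ((Measure.pi fun _ => uniformOn Set.univ).prod (Measure.pi fun _ => uniformOn Set.univ)))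

theorem productLaw_singleton_eq (ω ω' : A × B × (∀ i, C i) × (∀ i, D i)) :
    productLaw A B C D {ω} = productLaw A B C D {ω'} := by
  have : Nonempty A := ⟨ω.1⟩
  have : Nonempty B := ⟨ω.2.1⟩
  have : ∀ i, Nonempty (C i) := fun i => ⟨ω.2.2.1 i⟩
  have : ∀ i, Nonempty (D i) := fun i => ⟨ω.2.2.2 i⟩
  have h : ∀ ω : A × B × (∀ i, C i) × (∀ i, D i), productLaw A B C D {ω} =
      uniformOn Set.univ {ω.1} * (uniformOn Set.univ {ω.2.1} *
        ((∏ i, uniformOn Set.univ {ω.2.2.1 i}) * ∏ i, uniformOn Set.univ {ω.2.2.2 i})) := by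
    rintro ⟨a, b, c, d⟩
    unfold productLaw
    rw [← Set.singleton_prod_singleton, ← Set.singleton_prod_singleton,
      ← Set.singleton_prod_singleton]
    simp only [Measure.prod_prod, Measure.pi_singleton]
  rw [h, h, uniformOn_univ_singleton_eq ω.1 ω'.1, uniformOn_univ_singleton_eq ω.2.1 ω'.2.1,
    Finset.prod_congr rfl fun m _ => uniformOn_univ_singleton_eq (ω.2.2.1 m) (ω'.2.2.1 m),
    Finset.prod_congr rfl fun m _ => uniformOn_univ_singleton_eq (ω.2.2.2 m) (ω'.2.2.2 m)]

variable [Nonempty A] [Nonempty B] [∀ i, Nonempty (C i)] [∀ i, Nonempty (D i)]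

instance : IsProbabilityMeasure (productLaw A B C D) := by
  unfold productLaw
  infer_instance

theorem productLaw_le_of_injOn (g : (A × B × (∀ i, C i) × (∀ i, D i)) →
      A × B × (∀ i, C i) × (∀ i, D i)) {s t : Set (A × B × (∀ i, C i) × (∀ i, D i))}
    (hst : Set.MapsTo g s t) (hinj : Set.InjOn g s) :
    productLaw A B C D s ≤ productLaw A B C D t :=
  measure_le_of_injOn productLaw_singleton_eq g hst hinj

theorem productLaw_map_fst : (productLaw A B C D).map Prod.fst = uniformOn Set.univ := by
  unfold productLaw
  rw [Measure.map_fst_prod, measure_univ, one_smul]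

theorem productLaw_map_snd_fst :
    (productLaw A B C D).map (fun ω => ω.2.1) = uniformOn Set.univ := by
  unfold productLaw
  change Measure.map (Prod.fst ∘ Prod.snd) _ = _
  rw [← Measure.map_map measurable_fst measurable_snd,
    Measure.map_snd_prod, measure_univ, one_smul, Measure.map_fst_prod, measure_univ, one_smul]

theorem productLaw_map_left (i : ι) :
    (productLaw A B C D).map (fun ω => ω.2.2.1 i) = uniformOn Set.univ := by
  unfold productLaw
  change Measure.map (((Function.eval i ∘ Prod.fst) ∘ Prod.snd) ∘ Prod.snd) _ = _
  rw [← Measure.map_map .of_discrete measurable_snd, Measure.map_snd_prod, measure_univ, one_smul,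
    ← Measure.map_map .of_discrete measurable_snd, Measure.map_snd_prod, measure_univ, one_smul,
    ← Measure.map_map .of_discrete measurable_fst, Measure.map_fst_prod, measure_univ, one_smul,
    (measurePreserving_eval _ i).map_eq]

theorem productLaw_map_right (i : ι) :
    (productLaw A B C D).map (fun ω => ω.2.2.2 i) = uniformOn Set.univ := by
  unfold productLaw
  change Measure.map (((Function.eval i ∘ Prod.snd) ∘ Prod.snd) ∘ Prod.snd) _ = _
  rw [← Measure.map_map .of_discrete measurable_snd, Measure.map_snd_prod, measure_univ, one_smul,
    ← Measure.map_map .of_discrete measurable_snd, Measure.map_snd_prod, measure_univ, one_smul,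
    ← Measure.map_map .of_discrete measurable_snd, Measure.map_snd_prod, measure_univ, one_smul,
    (measurePreserving_eval _ i).map_eq]

/-- Functions of the components of an outcome are independent. -/
theorem productLaw_map_eq_prod {σ τ : Type*} {υ : ι → Type*} [MeasurableSpace σ]
    [MeasurableSpace τ] [∀ i, MeasurableSpace (υ i)] (f : A → σ) (g : B → τ) (k : ∀ i, D i → υ i) :
    (productLaw A B C D).map (fun ω => (f ω.1, g ω.2.1, (fun i => ω.2.2.1 i),
        fun i => k i (ω.2.2.2 i))) =
      ((productLaw A B C D).map fun ω => f ω.1).prod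
        (((productLaw A B C D).map fun ω => g ω.2.1).prod
        ((Measure.pi fun i => (productLaw A B C D).map fun ω => ω.2.2.1 i).prod
          (Measure.pi fun i => (productLaw A B C D).map fun ω => k i (ω.2.2.2 i)))) := by
  have hf : (productLaw A B C D).map (fun ω => f ω.1) = (uniformOn Set.univ).map f := by
    rw [← productLaw_map_fst (A := A) (B := B) (C := C) (D := D),
      Measure.map_map .of_discrete measurable_fst]
    rfl
  have hg : (productLaw A B C D).map (fun ω => g ω.2.1) = (uniformOn Set.univ).map g := by
    rw [← productLaw_map_snd_fst (A := A) (B := B) (C := C) (D := D),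
      Measure.map_map .of_discrete .of_discrete]
    rfl
  have hk : ∀ i, (productLaw A B C D).map (fun ω => k i (ω.2.2.2 i)) =
      (uniformOn Set.univ).map (k i) := by
    intro i
    rw [← productLaw_map_right (A := A) (B := B) (C := C) (D := D) i,
      Measure.map_map .of_discrete .of_discrete]
    rfl
  have h1 : ∀ i, IsProbabilityMeasure ((uniformOn (Set.univ : Set (D i))).map (k i)) := fun i =>
    Measure.isProbabilityMeasure_map Measurable.of_discrete.aemeasurable
  have h2 : IsProbabilityMeasure ((uniformOn (Set.univ : Set B)).map g) :=
    Measure.isProbabilityMeasure_map Measurable.of_discrete.aemeasurable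
  have h3 : IsProbabilityMeasure ((uniformOn (Set.univ : Set A)).map f) :=
    Measure.isProbabilityMeasure_map Measurable.of_discrete.aemeasurable
  rw [hf, hg]
  simp_rw [hk, productLaw_map_left]
  rw [← Measure.pi_map_pi (fun i => Measurable.of_discrete.aemeasurable)]
  conv_rhs => rw [← Measure.map_id (μ := Measure.pi fun i => uniformOn (Set.univ : Set (C i)))]
  rw [Measure.map_prod_map _ _ measurable_id .of_discrete,
    Measure.map_prod_map _ _ .of_discrete .of_discrete,
    Measure.map_prod_map _ _ .of_discrete .of_discrete]
  rfl

end ProductLaw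

/-! ### Cross-subspace alignment scheme -/

namespace CrossSubspace

open Polynomial

variable {F : Type} [Field F] {M N L q X E : ℕ} {K T : Fin M → ℕ}

/-- Tuples of indices, one for each user. -/
abbrev Idx (K : Fin M → ℕ) : Type := (m : Fin M) → Fin (K m)

/-- The share of the database stored at a server. -/
noncomputable def storage (e : F ≃ Fin q) (α : Fin N → F) (φ : Fin L → F)
    (D : (Idx K → Fin L → Fin q) × (Fin L → Idx K → Fin X → F)) (n : Fin N) :
    Fin L → Idx K → F :=
  fun l k => (share (e.symm (D.1 k l)) (D.2 l k) (φ l)).eval (α n)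

/-- The share of the indicator vector of an index that is sent to a server. -/
noncomputable def query {k t : ℕ} (α : Fin N → F) (φ : Fin L → F) (i : Fin k)
    (Z : Fin L → Fin k → Fin t → F) (n : Fin N) : Fin L → Fin k → F :=
  fun l κ => (share (if κ = i then 1 else 0) (Z l κ) (φ l)).eval (α n)

/-- The symbol returned by a server. -/
noncomputable def answer (α : Fin N → F) (φ : Fin L → F) (n : Fin N) (S : Fin L → Idx K → F)
    (Q : (m : Fin M) → Fin L → Fin (K m) → F) (c : Fin E → F) : F :=
  ∑ l, (φ l - α n)⁻¹ * ∑ k, S l k * ∏ m, Q m l (k m) + ∑ j : Fin E, α n ^ (j : ℕ) * c j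

/-- Answers consist of the desired message in a Cauchy part, and of interference aligned with the
common randomness in a Vandermonde part. -/
theorem exists_answer_eq (e : F ≃ Fin q) (α : Fin N → F) (φ : Fin L → F)
    (hne : ∀ l n, φ l ≠ α n) (hE : X + ∑ m, T m ≤ E)
    (D : (Idx K → Fin L → Fin q) × (Fin L → Idx K → Fin X → F)) (θ : Idx K)
    (Z : (m : Fin M) → Fin L → Fin (K m) → Fin (T m) → F) :
    ∃ c₀ : Fin E → F, ∀ n c,
      answer α φ n (storage e α φ D n) (fun m => query α φ (θ m) (Z m) n) c =
        ∑ l, (φ l - α n)⁻¹ * e.symm (D.1 θ l) + ∑ j : Fin E, α n ^ (j : ℕ) * (c₀ j + c j) := by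
  classical
  -- At `φ l` the query shares become indicators and only the tuple `θ` survives. Degrees add up to
  -- at most `X + ∑ T m`.
  let G : Fin L → F[X] := fun l => ∑ k : Idx K, share (e.symm (D.1 k l)) (D.2 l k) (φ l) *
    ∏ m, share (if k m = θ m then 1 else 0) (Z m l (k m)) (φ l)
  have hG : ∀ l, (G l).natDegree ≤ E := by
    intro l
    refine natDegree_sum_le_of_forall_le _ _ fun k _ => ?_
    refine natDegree_mul_le.trans (le_trans ?_ hE)
    refine add_le_add (natDegree_share_le _ _ _) ((natDegree_prod_le _ _).trans ?_)
    exact Finset.sum_le_sum fun m _ => natDegree_share_le _ _ _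
  have hGφ : ∀ l, (G l).eval (φ l) = e.symm (D.1 θ l) := by
    intro l
    simp only [G, eval_finsetSum, eval_mul, eval_prod, eval_share_self]
    rw [Finset.sum_eq_single θ]
    · simp
    · intro k _ hk
      obtain ⟨m, hm⟩ := Function.ne_iff.1 hk
      rw [Finset.prod_eq_zero (Finset.mem_univ m) (if_neg hm), mul_zero]
    · simp
  choose c hc using fun l => exists_inv_mul_eval_eq (hG l) (φ l)
  refine ⟨fun j => ∑ l, c l j, fun n c' => ?_⟩
  have h1 : ∀ l, ∑ k, storage e α φ D n l k * ∏ m, query α φ (θ m) (Z m) n l (k m) =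
      (G l).eval (α n) := by
    intro l
    simp only [G, eval_finsetSum, eval_mul, eval_prod]
    rfl
  simp only [answer, h1]
  rw [Finset.sum_congr rfl fun l _ => hc l (α n) (hne l n), Finset.sum_add_distrib]
  simp only [hGφ]
  rw [add_assoc, Finset.sum_comm, ← Finset.sum_add_distrib]
  congr 1
  refine Finset.sum_congr rfl fun j _ => ?_
  rw [mul_add, Finset.mul_sum]

end CrossSubspace

namespace CrossSubspace

section Construction

set_option linter.unusedSectionVars false
set_option synthInstance.maxSize 1000

/-- The database and the randomness of its storage. -/
abbrev Store (F : Type) (L q X : ℕ) {M : ℕ} (K : Fin M → ℕ) : Type :=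
  (Idx K → Fin L → Fin q) × (Fin L → Idx K → Fin X → F)

/-- The private randomness of a user. -/
abbrev Priv (F : Type) (L : ℕ) {M : ℕ} (K T : Fin M → ℕ) (m : Fin M) : Type :=
  Fin L → Fin (K m) → Fin (T m) → F

/-- Outcomes: database and storage randomness, common randomness, indices, private randomness. -/
abbrev Sample (F : Type) (L q X E : ℕ) {M : ℕ} (K T : Fin M → ℕ) : Type :=
  Store F L q X K × (Fin E → F) × Idx K × (∀ m, Priv F L K T m)

variable {F : Type} [Field F] {M N L q X E : ℕ} {K T : Fin M → ℕ} [Fintype F]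
  [MeasurableSpace F] [DiscreteMeasurableSpace F] [NeZero q] [∀ m, NeZero (K m)]

instance : DiscreteMeasurableSpace (Store F L q X K) := inferInstance

instance : DiscreteMeasurableSpace (Sample F L q X E K T) := inferInstance

instance : Finite (Sample F L q X E K T) := inferInstance

/-- All outcomes are equally likely. -/
noncomputable abbrev law (F : Type) (L q X E : ℕ) {M : ℕ} (K T : Fin M → ℕ)
    [MeasurableSpace F] : Measure (Sample F L q X E K T) :=
  productLaw (Store F L q X K) (Fin E → F) (fun m => Fin (K m)) (Priv F L K T)

instance : IsProbabilityMeasure (law F L q X E K T) := by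
  have : Nonempty F := ⟨0⟩
  infer_instance

theorem law_le_of_injOn (g : Sample F L q X E K T → Sample F L q X E K T)
    {s t : Set (Sample F L q X E K T)} (hst : Set.MapsTo g s t) (hinj : Set.InjOn g s) :
    law F L q X E K T s ≤ law F L q X E K T t := by
  have : Nonempty F := ⟨0⟩
  exact productLaw_le_of_injOn g hst hinj

theorem map_database_law :
    (law F L q X E K T).map (fun ω => ω.1.1) = uniformOn Set.univ := by
  refine map_eq_uniformOn _ fun a a' => ?_
  refine law_le_of_injOn (fun ω => ((a', ω.1.2), ω.2)) (fun ω _ => rfl) ?_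
  rintro ⟨⟨w, r⟩, ω⟩ hw ⟨⟨w', r'⟩, ω'⟩ hw' h
  have h1 : w = a := hw
  have h2 : w' = a := hw'
  simp only [Prod.mk.injEq, true_and] at h ⊢
  exact ⟨⟨h1.trans h2.symm, h.1⟩, h.2⟩

theorem map_index_law (m : Fin M) :
    (law F L q X E K T).map (fun ω => ω.2.2.1 m) = uniformOn Set.univ := by
  have : Nonempty F := ⟨0⟩
  exact productLaw_map_left m

variable (e : F ≃ Fin q) (α : Fin N → F) (φ : Fin L → F)

/-- Content of a server. -/
noncomputable def serverContent (n : Fin N) (ω : Sample F L q X E K T) : Fin L → Idx K → F :=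
  storage e α φ ω.1 n

/-- Query received by a server from a user. -/
noncomputable def serverQuery (m : Fin M) (n : Fin N) (ω : Sample F L q X E K T) :
    Fin L → Fin (K m) → F :=
  query α φ (ω.2.2.1 m) (ω.2.2.2 m) n

/-- Symbol returned by a server. -/
noncomputable def serverAnswer (n : Fin N) (ω : Sample F L q X E K T) : F :=
  answer α φ n (serverContent e α φ n ω) (fun m => serverQuery α φ m n ω) ω.2.1

variable {e α φ}

/-- Replacing database `a` by `a'` is compensated at the servers of `𝒳` by translating the storage
randomness. -/
theorem database_security (hα : Function.Injective α) (hne : ∀ l n, φ l ≠ α n)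
    (𝒳 : Finset (Fin N)) (h𝒳 : 𝒳.card ≤ X) :
    mutualInfo (law F L q X E K T) (fun ω => ω.1.1)
      (fun ω (n : 𝒳) => label (serverContent e α φ n ω)) = 0 := by
  refine mutualInfo_eq_zero_of_symmetric _ _ fun a a' b => ?_
  choose δ hδ using fun (l : Fin L) (k : Idx K) =>
    exists_share_shift α hα (φ l) (hne l) 𝒳 h𝒳 (e.symm (a k l)) (e.symm (a' k l))
  refine law_le_of_injOn (fun ω => ((a', fun l k => ω.1.2 l k + δ l k), ω.2)) ?_ ?_
  · rintro ⟨⟨w, r⟩, ω⟩ ⟨hw, hb⟩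
    have h1 : w = a := hw
    subst h1
    refine ⟨rfl, ?_⟩
    rw [← show _ = b from hb]
    funext n
    refine congrArg label ?_
    funext l k
    exact hδ l k n n.2 (r l k)
  · rintro ⟨⟨w, r⟩, ω⟩ ⟨hw, -⟩ ⟨⟨w', r'⟩, ω'⟩ ⟨hw', -⟩ h
    have h1 : w = a := hw
    have h2 : w' = a := hw'
    simp only [Prod.mk.injEq, true_and] at h ⊢
    refine ⟨⟨h1.trans h2.symm, ?_⟩, h.2⟩
    funext l k
    exact add_right_cancel (congrFun (congrFun h.1 l) k)

/-- A change of the index of user `m` is absorbed by translating that user's randomness. Storage,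
common randomness and the other users' queries stay put. -/
theorem index_privacy (hα : Function.Injective α) (hne : ∀ l n, φ l ≠ α n) (m : Fin M)
    (τ : Finset (Fin N)) (hτ : τ.card ≤ T m) :
    condMutualInfo (law F L q X E K T) (fun ω => ω.2.2.1 m)
      (fun ω (i : Fin M) (n : τ) => label (serverQuery α φ i n ω))
      (fun ω => ((fun n : τ => label (serverContent e α φ n ω)), label ω.2.1)) = 0 := by
  classical
  refine condMutualInfo_eq_zero_of_symmetric _ _ _ fun a a' b c => ?_
  choose δ hδ using fun (l : Fin L) (κ : Fin (K m)) =>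
    exists_share_shift α hα (φ l) (hne l) τ hτ (if κ = a then 1 else 0) (if κ = a' then 1 else 0)
  refine law_le_of_injOn (fun ω => (ω.1, ω.2.1, Function.update ω.2.2.1 m a',
    Function.update ω.2.2.2 m fun l κ => ω.2.2.2 m l κ + δ l κ)) ?_ ?_
  · rintro ⟨D, C, θ, Z⟩ ⟨hc, ha, hb⟩
    have h1 : θ m = a := ha
    refine ⟨hc, ?_, ?_⟩
    · simp
    · rw [← show _ = b from hb]
      funext i n
      refine congrArg label ?_
      by_cases hi : i = m
      · subst hi
        funext l κ
        simp only [serverQuery, query, Function.update_self, h1]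
        exact hδ l κ n n.2 (Z i l κ)
      · simp [serverQuery, hi]
  · rintro ⟨D, C, θ, Z⟩ ⟨-, ha, -⟩ ⟨D', C', θ', Z'⟩ ⟨-, ha', -⟩ h
    have h1 : θ m = a := ha
    have h2 : θ' m = a := ha'
    simp only [Prod.mk.injEq] at h ⊢
    refine ⟨h.1, h.2.1, ?_, ?_⟩
    · funext i
      by_cases hi : i = m
      · subst hi; rw [h1, h2]
      · simpa [hi] using congrFun h.2.2.1 i
    · funext i
      by_cases hi : i = m
      · subst hi
        have h3 := congrFun h.2.2.2 i
        simp only [Function.update_self] at h3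
        funext l κ
        exact add_right_cancel (congrFun (congrFun h3 l) κ)
      · simpa [hi] using congrFun h.2.2.2 i

/-- Answers depend only on the desired message and on the interference coefficients plus common
randomness. Change the other indices, swap the messages at the old and new tuples so that the
desired message is the same, and adjust the common randomness to keep each sum of coefficients. -/
theorem index_interUserPrivacy (hne : ∀ l n, φ l ≠ α n) (hE : X + ∑ m, T m ≤ E) (m : Fin M) :
    condMutualInfo (law F L q X E K T) (fun ω (i : {i : Fin M // i ≠ m}) => ω.2.2.1 i)
      (fun ω n => [e (serverAnswer e α φ n ω)])
      (fun ω => (ω.2.2.1 m, label (ω.2.2.2 m), ω.1.1 fun i => ω.2.2.1 i)) = 0 := by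
  classical
  have hdisc : DiscreteMeasurableSpace (Fin N → QString q) := inferInstance
  refine condMutualInfo_eq_zero_of_symmetric _ _ _ fun a a' b c => ?_
  choose I hI using fun (D : Store F L q X K) (θ : Idx K) (Z : ∀ m, Priv F L K T m) =>
    exists_answer_eq e α φ hne hE D θ Z
  let ext : Idx K → Idx K := fun θ i => if h : i ≠ m then a' ⟨i, h⟩ else θ i
  let shuffle : Store F L q X K → Idx K → Store F L q X K := fun D θ =>
    (fun k => D.1 (Equiv.swap θ (ext θ) k), D.2)
  refine law_le_of_injOn (fun ω => (shuffle ω.1 ω.2.2.1,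
    fun j => I ω.1 ω.2.2.1 ω.2.2.2 j + ω.2.1 j -
      I (shuffle ω.1 ω.2.2.1) (ext ω.2.2.1) ω.2.2.2 j, ext ω.2.2.1, ω.2.2.2)) ?_ ?_
  · rintro ⟨D, C, θ, Z⟩ ⟨hc, -, hb⟩
    have hw : (shuffle D θ).1 (ext θ) = D.1 θ := by simp [shuffle]
    refine ⟨?_, ?_, ?_⟩
    · rw [← show _ = c from hc]
      refine Prod.ext ?_ (Prod.ext rfl ?_)
      · simp [ext]
      · exact hw
    · funext i
      simp [ext, i.2]
    · rw [← show _ = b from hb]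
      funext n
      refine congrArg (fun x => [e x]) ?_
      change answer α φ n (storage e α φ (shuffle D θ) n)
        (fun m => query α φ (ext θ m) (Z m) n) _ =
        answer α φ n (storage e α φ D n) (fun m => query α φ (θ m) (Z m) n) C
      rw [hI, hI, hw]
      congr 1
      refine Finset.sum_congr rfl fun j _ => ?_
      simp only
      ring
  · rintro ⟨D, C, θ, Z⟩ ⟨-, ha, -⟩ ⟨D', C', θ', Z'⟩ ⟨-, ha', -⟩ h
    simp only [Prod.mk.injEq] at h
    obtain ⟨hD, hC, hθ, rfl⟩ := h
    -- Coordinate `m` is untouched by `ext`, and the remaining coordinates are prescribed by `a` on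
    -- the source set. This recovers `θ`, then the swapped database, then the common randomness.
    have h0 : θ = θ' := by
      funext i
      by_cases hi : i = m
      · subst hi
        simpa [ext] using congrFun hθ i
      · exact (congrFun ha ⟨i, hi⟩).trans (congrFun ha' ⟨i, hi⟩).symm
    subst h0
    have h1 : D = D' := by
      simp only [shuffle, Prod.mk.injEq] at hD
      refine Prod.ext ?_ hD.2
      funext k
      simpa using congrFun hD.1 (Equiv.swap θ (ext θ) k)
    subst h1
    simp only [Prod.mk.injEq, true_and, and_true]
    funext j
    exact add_left_cancel (sub_left_injective (congrFun hC j))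

/-- The difference of two equal answer vectors is a homogeneous Cauchy-Vandermonde system, whose
Cauchy part is the difference of the messages. -/
theorem message_eq_of_answer_eq (hα : Function.Injective α) (hφ : Function.Injective φ)
    (hne : ∀ l n, φ l ≠ α n) (hE : X + ∑ m, T m ≤ E) (hN : L + E ≤ N)
    (ω ω' : Sample F L q X E K T)
    (h : ∀ n, serverAnswer e α φ n ω = serverAnswer e α φ n ω') :
    ω.1.1 ω.2.2.1 = ω'.1.1 ω'.2.2.1 := by
  obtain ⟨c, hc⟩ := exists_answer_eq e α φ hne hE ω.1 ω.2.2.1 ω.2.2.2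
  obtain ⟨c', hc'⟩ := exists_answer_eq e α φ hne hE ω'.1 ω'.2.2.1 ω'.2.2.2
  have hz := cauchy_part_eq_zero hN α hα φ hφ hne
    (fun l => e.symm (ω.1.1 ω.2.2.1 l) - e.symm (ω'.1.1 ω'.2.2.1 l))
    (fun j => (c j + ω.2.1 j) - (c' j + ω'.2.1 j)) (fun n => by
      have h1 : _ = _ := h n
      unfold serverAnswer at h1
      have h2 := (hc n ω.2.1).symm.trans (h1.trans (hc' n ω'.2.1))
      simp only [mul_sub, Finset.sum_sub_distrib]
      linear_combination h2)
  funext l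
  exact e.symm.injective (sub_eq_zero.1 (congrFun hz l))

theorem database_eq_of_content_eq (hα : Function.Injective α) (hX : X < N)
    (ω ω' : Sample F L q X E K T)
    (h : ∀ n, serverContent e α φ n ω = serverContent e α φ n ω') : ω.1.1 = ω'.1.1 := by
  funext k l
  exact e.symm.injective (share_secret_eq hX α hα (φ l) _ _ (ω.1.2 l k) (ω'.1.2 l k)
    fun n => congrFun (congrFun (h n) l) k)

/-- Cross-subspace alignment scheme. -/
noncomputable def scheme (e : F ≃ Fin q) (α : Fin N → F) (φ : Fin L → F)
    (hα : Function.Injective α) (hφ : Function.Injective φ) (hne : ∀ l n, φ l ≠ α n)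
    (hE : X + ∑ m, T m ≤ E) (hN : L + E ≤ N) (hL : 1 ≤ L) : Scheme q L N X K T where
  Ω := Sample F L q X E K T
  μ := law F L q X E K T
  W ω := ω.1.1
  S n ω := label (serverContent e α φ n ω)
  θ m ω := ω.2.2.1 m
  Z m ω := label (ω.2.2.2 m)
  Zc ω := label ω.2.1
  Q m n ω := label (serverQuery α φ m n ω)
  A n ω := [e (serverAnswer e α φ n ω)]
  measurable_W := .of_discrete
  measurable_S _ := .of_discrete
  measurable_θ _ := .of_discrete
  measurable_Z _ := .of_discrete
  measurable_Zc := .of_discrete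
  measurable_Q _ _ := .of_discrete
  measurable_A _ := .of_discrete
  uniform_W := map_database_law
  uniform_θ := map_index_law
  stored := condEntropy_eq_zero_of_determines _ _ fun ω ω' h =>
    database_eq_of_content_eq hα (by omega) ω ω' fun n => label_injective (congrFun h n)
  security := database_security hα hne
  replicated := by
    intro hX n
    have h : ∀ (ω : Sample F L q X E K T) l k,
        serverContent e α φ n ω l k = e.symm (ω.1.1 k l) := by
      intro ω l k
      subst hX
      -- Without security a share is the constant polynomial given by its secret, so storage is
      -- replicated.
      simp [serverContent, storage]
    constructor
    · refine condEntropy_eq_zero_of_determines _ _ fun ω ω' hW => congrArg label ?_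
      funext l k
      rw [h, h, hW]
    · refine condEntropy_eq_zero_of_determines _ _ fun ω ω' hS => ?_
      funext k l
      have := congrFun (congrFun (label_injective hS) l) k
      rw [h, h] at this
      exact e.symm.injective this
  independent := by
    have : Nonempty F := ⟨0⟩
    exact productLaw_map_eq_prod (A := Store F L q X K) (B := Fin E → F)
      (C := fun m => Fin (K m)) (D := Priv F L K T)
      (fun D n => label (storage e α φ D n)) label fun _ => label
  query m := condEntropy_eq_zero_of_determines _ _ fun ω ω' h => by
    have h1 : ω.2.2.1 m = ω'.2.2.1 m := congrArg Prod.fst h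
    have h2 : ω.2.2.2 m = ω'.2.2.2 m := label_injective (congrArg Prod.snd h)
    funext n
    simp only [serverQuery, h1, h2]
  answer n := condEntropy_eq_zero_of_determines _ _ fun ω ω' h => by
    have h1 : serverContent e α φ n ω = serverContent e α φ n ω' :=
      label_injective (congrArg Prod.fst h)
    have h2 : (fun m => serverQuery α φ m n ω) = fun m => serverQuery α φ m n ω' := by
      funext m
      exact label_injective (congrFun (congrArg (fun p => p.2.1) h) m)
    have h3 : ω.2.1 = ω'.2.1 := label_injective (congrArg (fun p => p.2.2) h)
    simp only [serverAnswer, h1, h2, h3]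
  prefixFree n v a b ha hb hp := by
    obtain ⟨ω, -, hω⟩ := nonempty_of_measure_ne_zero ha
    obtain ⟨ω', -, hω'⟩ := nonempty_of_measure_ne_zero hb
    exact hp.eq_of_length ((congrArg List.length hω).symm.trans
      (List.length_singleton.trans (List.length_singleton.symm.trans
        (congrArg List.length hω'))))
  privacy := index_privacy hα hne
  interUserPrivacy := index_interUserPrivacy hne hE
  correct m := condEntropy_eq_zero_of_determines _ _ fun ω ω' h =>
    message_eq_of_answer_eq hα hφ hne hE hN ω ω' fun n => by
      have h1 := congrFun (congrArg Prod.fst h) n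
      exact e.injective (List.singleton_injective h1)

theorem le_rate_scheme (e : F ≃ Fin q) (α : Fin N → F) (φ : Fin L → F)
    (hα : Function.Injective α) (hφ : Function.Injective φ) (hne : ∀ l n, φ l ≠ α n)
    (hE : X + ∑ m, T m ≤ E) (hN : L + E ≤ N) (hL : 1 ≤ L) :
    (L : ℝ≥0∞) / N ≤ (scheme (K := K) (T := T) (X := X) e α φ hα hφ hne hE hN hL).rate := by
  set s := scheme (K := K) (T := T) (X := X) e α φ hα hφ hne hE hN hL with hs
  have hD : s.downloadCost ≤ N := by
    refine iSup₂_le fun a ha => ?_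
    obtain ⟨ω, hω⟩ := nonempty_of_measure_ne_zero ha
    have h1 : ∀ n, (a n).length = 1 := fun n =>
      (congrArg List.length (hω n)).symm.trans List.length_singleton
    simp [h1]
  refine ENNReal.div_le_div_left ?_ _
  have := ENat.toENNReal_mono hD
  simpa using this

end Construction

end CrossSubspace

/-- If the privacy and security levels exhaust the servers, the bound is nonpositive. Otherwise the
scheme is used with `E = X + ∑ T m` and `L = N - E`. -/
theorem le_capacity {M : ℕ} (N X : ℕ) (K T : Fin M → ℕ) (hK : ∀ m, 1 ≤ K m)
    (hN : 0 < N) :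
    ENNReal.ofReal (1 - ((X : ℝ) + ∑ m, (T m : ℝ)) / (N : ℝ)) ≤ capacity N X K T := by
  rcases le_or_gt N (X + ∑ m, T m) with hle | hlt
  · rw [ENNReal.ofReal_of_nonpos]
    · exact zero_le
    · have h0 : (0 : ℝ) < N := by exact_mod_cast hN
      rw [sub_nonpos, one_le_div h0]
      exact_mod_cast hle
  -- A prime field with at least `2 * N ≥ L + N` elements has room for all the distinct points `φ l`
  -- and `α n`.
  · obtain ⟨p, hp, hprime⟩ := Nat.exists_infinite_primes (2 * N)
    have := Fact.mk hprime
    have : NeZero p := ⟨hprime.ne_zero⟩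
    have : ∀ m, NeZero (K m) := fun m => ⟨by have := hK m; omega⟩
    let _ : MeasurableSpace (ZMod p) := ⊤
    have : DiscreteMeasurableSpace (ZMod p) := ⟨fun _ => trivial⟩
    obtain ⟨L, hL⟩ : ∃ L, L = N - (X + ∑ m, T m) := ⟨_, rfl⟩
    have hcard : Fintype.card (Fin L ⊕ Fin N) ≤ Fintype.card (ZMod p) := by
      rw [ZMod.card, Fintype.card_sum, Fintype.card_fin, Fintype.card_fin]
      omega
    obtain ⟨f⟩ := Function.Embedding.nonempty_of_card_le hcard
    have hrate := CrossSubspace.le_rate_scheme (K := K) (T := T) (X := X) (E := X + ∑ m, T m)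
      (Fintype.equivFinOfCardEq (ZMod.card p)) (fun n => f (.inr n)) (fun l => f (.inl l))
      (f.injective.comp Sum.inr_injective) (f.injective.comp Sum.inl_injective)
      (fun l n h => by simpa using f.injective h) le_rfl (by omega) (by omega)
    refine le_trans (le_of_eq ?_) (hrate.trans ((le_iSup _ _).trans
      (le_iSup₂_of_le (f := fun q (_ : IsPrimePow q) => ⨆ (L : ℕ) (_ : 1 ≤ L), supRate q L N X K T)
        p hprime.isPrimePow (le_iSup₂_of_le (f := fun L (_ : 1 ≤ L) => supRate p L N X K T)
        L (by omega) le_rfl))))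
    have h0 : (0 : ℝ) < N := by exact_mod_cast hN
    have h1 : (1 : ℝ) - ((X : ℝ) + ∑ m, (T m : ℝ)) / N = (L : ℝ) / N := by
      rw [hL, Nat.cast_sub hlt.le]
      push_cast
      field_simp
    rw [h1, ENNReal.ofReal_div_of_pos h0, ENNReal.ofReal_natCast, ENNReal.ofReal_natCast]

end MBXSTPIR

theorem corollary2 (M N X : ℕ) (K T : Fin M → ℕ) (hM : 1 ≤ M) (hK : ∀ m, 1 ≤ K m)
    (hN : ∀ m, X + T m < N) :
    ENNReal.ofReal (1 - ((X : ℝ) + ∑ m, (T m : ℝ)) / (N : ℝ)) ≤ MBXSTPIR.capacity N X K T ∧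
    MBXSTPIR.capacity N X K T ≤
      ⨅ m : Fin M, ENNReal.ofReal
        ((1 - ((T m : ℝ) + (X : ℝ)) / (N : ℝ)) /
          (1 - ((T m : ℝ) / ((N : ℝ) - (X : ℝ))) ^ K m)) := by
  have : NeZero M := ⟨by omega⟩
  exact ⟨MBXSTPIR.le_capacity N X K T hK (by have := hN 0; omega),
    MBXSTPIR.capacity_le N X K T hK hN⟩
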